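/- Setting. For all $p,n\in\mathbb N$ let $\mathcal A_{p,n}:\mathbb R^p\times(\mathbb R\times\mathbb R^p)^n\to\mathbb R$ be a Borel measurable function (the prediction algorithm) that is symmetric, i.e. $\mathcal A_{p,n}(x,T)$ does not change when the $n$ pairs in $T$ are permuted. For every $n\ge 2$ let $p_n\in\mathbb N$, let $\mathcal P_n$ be a Borel probability measure on $\mathbb R\times\mathbb R^{p_n}$, and let $(y_i,x_i)=(y_i^{(n)},x_i^{(n)})$, $1\le i\le n+1$, be i.i.d. with law $\mathcal P_n$. Write $T_n=(y_i,x_i)_{i=1}^n$, and let $T_n^{\backslash i}$ be $T_n$ with the $i$-th pair removed. Put $\hat y_{n+1}=\mathcal A_{p_n,n}(x_{n+1},T_n)$, $\hat y_{j}^{\backslash i}=\mathcal A_{p_n,n-1}(x_{j},T_n^{\backslash i})$ for $1\le i\le n$, $1\le j\le n+1$, and $\hat u_i=y_i-\hat y_i^{\backslash i}$. Let $\widehat F_n(t)=\frac1n\sum_{i=1}^n \mathbf 1\{\hat u_i\le t\}$ and, for $\alpha\in\mathbb R$, $Q_\alpha(\widehat F_n)=\inf\{x\in\mathbb R:\widehat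 F_n(x)\ge\alpha\}\in[-\infty,+\infty]$ (with $\inf\emptyset=+\infty$). For $0\le\alpha_1\le\alpha_2\le1$ and $\delta\in\mathbb R$ the $\delta$-distorted Jackknife prediction interval is $$PI_{\alpha_1,\alpha_2}(\delta)=\hat y_{n+1}+\big[\,Q_{\alpha_1}(\widehat F_n)-\delta,\;Q_{\alpha_2}(\widehat F_n)+\delta\,\big],$$ where $[a,b]=\emptyset$ if $a>b$, and $PI_{\alpha_1,\alpha_2}(\delta)$ is regarded as a subset of $\mathbb R$. Conditional probabilities given $T_n$ are computed with a regular conditional distribution of $(y_{n+1},x_{n+1})$ given $T_n$. Proposition (Necessity of a stabilizing variance in $L_{2+\xi}$). Assume that for some $\xi>0$ the absolute moments $\mathbb E|\hat y_{n+1}|^{2+\xi}$, $\mathbb E|\hat y_{n+1}^{\backslash n}|^{2+\xi}$ and $\mathbb E|y_{n+1}|^{2+\xi}$ are bounded uniformly over $n\ge2$, and that the one-step-update drift vanishes in $L_2$: $$\lim_{n\to\infty}\mathbb E\Big(\big(\mathbb E(\hat y_{n+1}\,|\,T_n^{\backslash n},x_{n+1})-\hat y_{n+1}^{\backslash n}\big)^2\Big)=0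 .$$ Let $\sigma_n^2$ and $\sigma_{n-1}^2$ denote the variances of $\hat y_{n+1}$ and $\hat y_{n+1}^{\backslash n}$, respectively (both under $\mathcal P_n$). Then the following two statements are equivalent. 1. The Jackknife intervals are asymptotically uniformly conditionally conservative: for all $\epsilon>0$ and all $\delta>0$, $$\lim_{n\to\infty}\mathbb P\Big(\inf_{0\le\alpha_1\le\alpha_2\le1}\big[\mathbb P(y_{n+1}\in PI_{\alpha_1,\alpha_2}(\delta)\,|\,T_n)-(\alpha_2-\alpha_1)\big]\ge-\epsilon\Big)=1 .$$ 2. The variance stabilizes: $\lim_{n\to\infty}(\sigma_n^2-\sigma_{n-1}^2)=0$. -/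

import Mathlib

open MeasureTheory ProbabilityTheory Filter Topology
open scoped ENNReal NNReal

/-- A response-feature pair `(y, x)` with a real response and `p` real features. -/
abbrev Obs (p : ℕ) : Type := ℝ × EuclideanSpace ℝ (Fin p)

/-- A family of prediction algorithms: `A p n x T` is the prediction of the response that belongs
to the feature vector `x ∈ ℝ^p`, computed from the training data `T` of size `n`. -/
abbrev PredictionAlgorithm : Type :=
  ∀ p n : ℕ, EuclideanSpace ℝ (Fin p) → (Fin n → Obs p) → ℝ

/-- Every `A p n` is Borel measurable, jointly in the new feature vector and the training data. -/
def PredictionAlgorithm.IsMeasurable (A : PredictionAlgorithm) : Prop :=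
  ∀ p n : ℕ, Measurable fun q : EuclideanSpace ℝ (Fin p) × (Fin n → Obs p) => A p n q.1 q.2

/-- No prediction changes when the training data are permuted. -/
def PredictionAlgorithm.IsSymmetric (A : PredictionAlgorithm) : Prop :=
  ∀ (p n : ℕ) (x : EuclideanSpace ℝ (Fin p)) (T : Fin n → Obs p) (π : Equiv.Perm (Fin n)),
    A p n x (fun i => T (π i)) = A p n x T

/-- The random elements `Z 0, …, Z (N - 1)` are i.i.d. with law `P`. -/
structure IsIIDSample {Ω S : Type*} [MeasurableSpace Ω] [MeasurableSpace S] {N : ℕ}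
    (Z : Fin N → Ω → S) (P : Measure S) (μ : Measure Ω) : Prop where
  measurable : ∀ i, Measurable (Z i)
  indep : iIndepFun Z μ
  law : ∀ i, μ.map (Z i) = P

/-- The `α`-quantile `inf {x ∈ ℝ : F x ≥ α}`, an extended real number
(`+∞` for the infimum of the empty set), for every real `α`. -/
noncomputable def quantile (F : ℝ → ℝ) (α : ℝ) : EReal :=
  sInf ((fun x : ℝ => (x : EReal)) '' {x : ℝ | α ≤ F x})

section Jackknife

variable {p n : ℕ}

/-- The leave-one-out residual `y_i - ŷ_i^{\i}` of the training data `T` (of size `n + 1`):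
the prediction at `x_i` uses the training data without the `i`-th pair. -/
def looResidual (A : PredictionAlgorithm) (T : Fin (n + 1) → Obs p) (i : Fin (n + 1)) : ℝ :=
  (T i).1 - A p n (T i).2 (i.removeNth T)

open Classical in
/-- The empirical distribution function of the leave-one-out residuals. -/
noncomputable def jackknifeCDF (A : PredictionAlgorithm) (T : Fin (n + 1) → Obs p) (t : ℝ) : ℝ :=
  (1 / ((n + 1 : ℕ) : ℝ)) * ∑ i : Fin (n + 1), if looResidual A T i ≤ t then (1 : ℝ) else 0

/-- The `δ`-distorted Jackknife prediction interval
`ŷ + [Q_{α₁} - δ, Q_{α₂} + δ]` (its real points) for the response at the feature vector `x`,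
where `Q_α` are the quantiles of the empirical distribution of the leave-one-out residuals. -/
noncomputable def jackknifePI (A : PredictionAlgorithm) (α₁ α₂ δ : ℝ)
    (x : EuclideanSpace ℝ (Fin p)) (T : Fin (n + 1) → Obs p) : Set ℝ :=
  {y : ℝ |
    (A p (n + 1) x T : EReal) + (quantile (jackknifeCDF A T) α₁ - (δ : EReal)) ≤ (y : EReal) ∧
    (y : EReal) ≤ (A p (n + 1) x T : EReal) + (quantile (jackknifeCDF A T) α₂ + (δ : EReal))}

variable {Ω : Type*}

/-- The training data `T_N = (Z_1, …, Z_N)` contained in the `N + 1` observed pairs. -/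
def trainingData {N : ℕ} (Z : Fin (N + 1) → Ω → Obs p) (ω : Ω) : Fin N → Obs p :=
  fun i => Z i.castSucc ω

/-- The training data without their last pair. -/
def trainingDataLoo (Z : Fin (n + 1 + 1) → Ω → Obs p) (ω : Ω) : Fin n → Obs p :=
  (Fin.last n).removeNth (trainingData Z ω)

/-- The new pair `(y_{N+1}, x_{N+1})`. -/
def newPair {N : ℕ} (Z : Fin (N + 1) → Ω → Obs p) (ω : Ω) : Obs p :=
  Z (Fin.last N) ω

/-- The predictor `ŷ_{N+1}` of the new response from all `N` training pairs. -/
def predictor {N : ℕ} (A : PredictionAlgorithm) (Z : Fin (N + 1) → Ω → Obs p) (ω : Ω) : ℝ :=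
  A p N (newPair Z ω).2 (trainingData Z ω)

/-- The predictor `ŷ_{N+1}^{\N}` of the new response from the training data without
their last pair (`N = n + 1`). -/
def predictorLoo (A : PredictionAlgorithm) (Z : Fin (n + 1 + 1) → Ω → Obs p) (ω : Ω) : ℝ :=
  A p n (newPair Z ω).2 (trainingDataLoo Z ω)

variable [MeasurableSpace Ω]

/-- The one-step-update drift `E(ŷ_{N+1} | T_N^{\N}, x_{N+1}) - ŷ_{N+1}^{\N}`. -/
noncomputable def updateDrift (A : PredictionAlgorithm) (Z : Fin (n + 1 + 1) → Ω → Obs p)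
    (μ : Measure Ω) (ω : Ω) : ℝ :=
  (μ[predictor A Z |
    MeasurableSpace.comap (fun ω => (trainingDataLoo Z ω, (newPair Z ω).2)) inferInstance]) ω
    - predictorLoo A Z ω

/-- The conditional coverage probability `P(y_{N+1} ∈ PI_{α₁,α₂}(δ) | T_N)`, computed with the
regular conditional distribution of the new pair given the training data (one version for
all `α₁, α₂`). -/
noncomputable def condCoverage (A : PredictionAlgorithm) (Z : Fin (n + 1 + 1) → Ω → Obs p)
    (μ : Measure Ω) [IsFiniteMeasure μ] (α₁ α₂ δ : ℝ) (ω : Ω) : ℝ :=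
  (condDistrib (newPair Z) (trainingData Z) μ (trainingData Z ω)).real
    {z : Obs p | z.1 ∈ jackknifePI A α₁ α₂ δ z.2 (trainingData Z ω)}

/-- `inf_{0 ≤ α₁ ≤ α₂ ≤ 1} [P(y_{N+1} ∈ PI_{α₁,α₂}(δ) | T_N) - (α₂ - α₁)]`. -/
noncomputable def worstCoverageGap (A : PredictionAlgorithm) (Z : Fin (n + 1 + 1) → Ω → Obs p)
    (μ : Measure Ω) [IsFiniteMeasure μ] (δ : ℝ) (ω : Ω) : ℝ :=
  ⨅ a : {a : ℝ × ℝ // 0 ≤ a.1 ∧ a.1 ≤ a.2 ∧ a.2 ≤ 1},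
    (condCoverage A Z μ a.1.1 a.1.2 δ ω - (a.1.2 - a.1.1))

end Jackknife

/-- The absolute `q`-th moments of the random variables `X 0, X 1, …` (each on its own
probability space) are bounded by one finite constant. -/
def UniformlyBoundedMoments {Ω : ℕ → Type*} [∀ k, MeasurableSpace (Ω k)]
    (μ : ∀ k, Measure (Ω k)) (X : ∀ k, Ω k → ℝ) (q : ℝ) : Prop :=
  ∃ C : ℝ≥0, ∀ k, ∫⁻ ω, ‖X k ω‖ₑ ^ q ∂(μ k) ≤ C

/-!
The argument compares the prediction error `u = y - ŷ` of the full sample with its leave-one-out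
counterpart `u' = y - ŷ'`, and reduces both sides of the equivalence to the statement that the mean
squared update `E (ŷ - ŷ')²` tends to zero.

*Variance.* The last training pair is independent of the new pair and of the other training pairs,
so conditioning on the new response as well does not change the conditional mean of `ŷ`
(`condExp_predictor_comap_newPair`). Hence the update `ŷ - ŷ'` integrates like its drift against
`1`, `ŷ'` and `y`, and these integrals are negligible by the Cauchy-Schwarz inequality. Expanding squares
shows that `Var ŷ - Var ŷ'` and `E u² - E u'²` both differ from `E (ŷ - ŷ')²` by a null sequence
(`abs_variance_sub_sub_integral_sq_le`, `abs_integral_sq_error_sub_sub_integral_sq_le`).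

*Conservativeness implies stability.* Taking `α₁ = 0`, respectively `α₂ = 1`, coverage at all levels
forces the empirical distribution function of the leave-one-out residuals and the conditional
distribution function of `u` to be close in the Lévy sense. Their means are the distribution
functions of `u'` and `u` (`levy_close_of_measureReal_coverage_ge`), and the bound on the moments of
order `2 + ξ` turns this into convergence of `E u² - E u'²` to zero
(`integral_sq_le_of_levy_close`).

*Stability implies conservativeness.* Indicators of half-lines are replaced by Lipschitz functions.
For a symmetric functional with values in `[0, 1]` that hardly changes in `L₁` when one observation
is added, the average of the leave-one-out values concentrates in mean square around the mean at an
independent test point (`IsUnitFunctional.integral_sq_average_sub_integral_le`): in the off-diagonal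
terms of the expanded square, an additional independent observation is exchanged for the two
observations involved, one at a time, after which the two factors are conditionally independent and
centred. Only samples of size `n - 1` and `n` occur in these exchanges, so that the assumption on
one sample size is enough. A finite grid and a Markov bound for the tails give uniform Lévy
closeness (`levy_close_of_grid`), and thereby coverage at all levels simultaneously
(`coverage_ge_of_levy_close`).
-/

/-! ### Exchangeability of product measures -/

section Exchangeability

variable {E : Type*} [MeasurableSpace E] {P : Measure E} [IsProbabilityMeasure P]

lemma measurePreserving_cons (P : Measure E) [IsProbabilityMeasure P] (n : ℕ) :
    MeasurePreserving (fun q : E × (Fin n → E) => (Fin.cons q.1 q.2 : Fin (n + 1) → E))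
      (P.prod (Measure.pi fun _ => P)) (Measure.pi fun _ => P) := by
  have h := (measurePreserving_piFinSuccAbove (fun _ : Fin (n + 1) => P) 0).symm
  convert h using 1
  ext q i
  simp [MeasurableEquiv.piFinSuccAbove, Fin.insertNthEquiv]

lemma measurePreserving_removeNth (P : Measure E) [IsProbabilityMeasure P] {n : ℕ}
    (i : Fin (n + 1)) :
    MeasurePreserving (fun T : Fin (n + 1) → E => (T i, i.removeNth T))
      (Measure.pi fun _ => P) (P.prod (Measure.pi fun _ => P)) :=
  measurePreserving_piFinSuccAbove (fun _ : Fin (n + 1) => P) i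

lemma measurePreserving_comp_perm (P : Measure E) [IsProbabilityMeasure P] {n : ℕ}
    (σ : Equiv.Perm (Fin n)) :
    MeasurePreserving (fun T : Fin n → E => fun i => T (σ i))
      (Measure.pi fun _ => P) (Measure.pi fun _ => P) := by
  have h := measurePreserving_piCongrLeft (fun _ : Fin n => P) σ.symm
  convert h using 1
  ext T i
  have := MeasurableEquiv.piCongrLeft_apply_apply (β := fun _ : Fin n => E) σ.symm T (σ i)
  simpa using this.symm

lemma measurePreserving_swap_fst {R : Type*} [MeasurableSpace R] (P : Measure E)
    [IsProbabilityMeasure P] (ρ : Measure R) [IsProbabilityMeasure ρ] :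
    MeasurePreserving (fun q : E × E × R => (q.2.1, q.1, q.2.2))
      (P.prod (P.prod ρ)) (P.prod (P.prod ρ)) := by
  have h1 := (measurePreserving_prodAssoc P P ρ).symm
  have h2 := (Measure.measurePreserving_swap (μ := P) (ν := P)).prod (MeasurePreserving.id ρ)
  exact (measurePreserving_prodAssoc P P ρ).comp (h2.comp h1)

/-- Deleting the `i`-th entry after a permutation amounts to permuting what is left after the
deletion of the `σ i`-th entry. -/
lemma exists_perm_removeNth_comp {E : Type*} {n : ℕ} (σ : Equiv.Perm (Fin (n + 1)))
    (i : Fin (n + 1)) :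
    ∃ τ : Equiv.Perm (Fin n), ∀ T : Fin (n + 1) → E,
      i.removeNth (fun j => T (σ j)) = fun j => (σ i).removeNth T (τ j) := by
  have hne : ∀ j, σ (i.succAbove j) ≠ σ i := fun j h =>
    Fin.succAbove_ne i j (σ.injective h)
  choose f hf using fun j => Fin.exists_succAbove_eq (hne j)
  have hinj : Function.Injective f := fun a b hab => by
    have := congrArg (σ i).succAbove hab
    rw [hf, hf] at this
    exact Fin.succAbove_right_injective (σ.injective this)
  refine ⟨Equiv.ofBijective f (Finite.injective_iff_bijective.1 hinj), fun T => ?_⟩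
  ext j
  simp [Fin.removeNth, hf]

end Exchangeability

/-! ### Concentration of leave-one-out averages -/

section Concentration

lemma MeasureTheory.MeasurePreserving.integral_comp_of_measurable {X Y : Type*}
    [MeasurableSpace X] [MeasurableSpace Y] {ρ : Measure X} {ν : Measure Y} {φ : X → Y}
    (hφ : MeasurePreserving φ ρ ν) {f : Y → ℝ} (hf : Measurable f) :
    ∫ x, f (φ x) ∂ρ = ∫ y, f y ∂ν := by
  rw [← hφ.map_eq, integral_map hφ.measurable.aemeasurable hf.aestronglyMeasurable]

variable {E : Type*} [MeasurableSpace E] (P : Measure E) {n : ℕ}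

/-- A symmetric measurable functional of a test point and training data of size `k`, with values in
the unit interval. -/
structure IsUnitFunctional {k : ℕ} (F : E → (Fin k → E) → ℝ) : Prop where
  measurable : Measurable fun q : E × (Fin k → E) => F q.1 q.2
  mem_Icc : ∀ z T, F z T ∈ Set.Icc (0 : ℝ) 1
  symm : ∀ z T, ∀ σ : Equiv.Perm (Fin k), F z (fun i => T (σ i)) = F z T

lemma IsUnitFunctional.measurable_left {k : ℕ} {F : E → (Fin k → E) → ℝ}
    (hF : IsUnitFunctional F) (T : Fin k → E) : Measurable fun z => F z T :=
  hF.measurable.comp (by fun_prop : Measurable fun z => (z, T))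

/-- The change of a prediction-type functional at the test point `q.1` when the observation
`q.2.1` is added to the training data `q.2.2`. -/
def updateGap (F : E → (Fin (n + 1) → E) → ℝ) (F' : E → (Fin n → E) → ℝ)
    (q : E × E × (Fin n → E)) : ℝ :=
  |F q.1 (Fin.cons q.2.1 q.2.2) - F' q.1 q.2.2|

/-- The leave-one-out value at the `i`-th observation, centred by the mean value of the
full-sample functional at an independent test point. -/
noncomputable def looDeviation (F : E → (Fin (n + 1) → E) → ℝ) (F' : E → (Fin n → E) → ℝ)
    (i : Fin (n + 1)) (T : Fin (n + 1) → E) : ℝ :=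
  F' (T i) (i.removeNth T) - ∫ z, F z T ∂P

/-- The value of the functional at `q.2.1`, trained on `q.1` and `q.2.2`, centred by its mean over
an independent test point. -/
noncomputable def decoupledDeviation (F' : E → (Fin (n + 1) → E) → ℝ)
    (q : E × E × (Fin n → E)) : ℝ :=
  F' q.2.1 (Fin.cons q.1 q.2.2) - ∫ z, F' z (Fin.cons q.1 q.2.2) ∂P

lemma measurable_fin_cons {X : Type*} [MeasurableSpace X] {f : X → E} {g : X → Fin n → E}
    (hf : Measurable f) (hg : Measurable g) :
    Measurable fun x => (Fin.cons (f x) (g x) : Fin (n + 1) → E) := by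
  refine measurable_pi_iff.2 fun i => ?_
  refine Fin.cases ?_ (fun j => ?_) i
  · simpa using hf
  · simpa using measurable_pi_iff.1 hg j

lemma cons_cons_eq_comp_swap {E : Type*} {n : ℕ} (a b : E) (S : Fin n → E) :
    (Fin.cons a (Fin.cons b S : Fin (n + 1) → E) : Fin (n + 2) → E) =
      fun i => (Fin.cons b (Fin.cons a S : Fin (n + 1) → E) : Fin (n + 2) → E)
        (Equiv.swap 0 1 i) := by
  ext i
  refine Fin.cases ?_ (fun j => Fin.cases ?_ (fun k => ?_) j) i
  · simp
  · simp
  · rw [Equiv.swap_apply_of_ne_of_ne (Fin.succ_ne_zero _)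
      (by simp [Fin.ext_iff])]
    simp

lemma IsUnitFunctional.looDeviation_comp_perm {F : E → (Fin (n + 2) → E) → ℝ}
    {F' : E → (Fin (n + 1) → E) → ℝ} (hF : IsUnitFunctional F)
    (hF' : IsUnitFunctional F') (σ : Equiv.Perm (Fin (n + 2))) (i : Fin (n + 2))
    (T : Fin (n + 2) → E) :
    looDeviation P F F' i (fun j => T (σ j)) = looDeviation P F F' (σ i) T := by
  obtain ⟨τ, hτ⟩ := exists_perm_removeNth_comp (E := E) σ i
  simp only [looDeviation, hτ, hF'.symm, hF.symm]

variable [IsProbabilityMeasure P]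
  {F : E → (Fin (n + 2) → E) → ℝ} {F' : E → (Fin (n + 1) → E) → ℝ}

lemma integrable_of_mem_Icc_zero_one {X : Type*} [MeasurableSpace X] {ρ : Measure X}
    [IsFiniteMeasure ρ] {f : X → ℝ} (hf : Measurable f) (h : ∀ x, f x ∈ Set.Icc (0 : ℝ) 1) :
    Integrable f ρ :=
  Integrable.of_bound hf.aestronglyMeasurable 1 (ae_of_all _ fun x => by
    rw [Real.norm_eq_abs, abs_of_nonneg (h x).1]; exact (h x).2)

lemma integrable_of_abs_le_one {X : Type*} [MeasurableSpace X] {ρ : Measure X}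
    [IsFiniteMeasure ρ] {f : X → ℝ} (hf : Measurable f) (h : ∀ x, |f x| ≤ 1) :
    Integrable f ρ :=
  Integrable.of_bound hf.aestronglyMeasurable 1 (ae_of_all _ h)

lemma integral_mem_Icc_zero_one {X : Type*} [MeasurableSpace X] {ρ : Measure X}
    [IsProbabilityMeasure ρ] {f : X → ℝ} (hf : Measurable f) (h : ∀ x, f x ∈ Set.Icc (0 : ℝ) 1) :
    ∫ x, f x ∂ρ ∈ Set.Icc (0 : ℝ) 1 := by
  refine ⟨integral_nonneg fun x => (h x).1, ?_⟩
  calc ∫ x, f x ∂ρ ≤ ∫ _, (1 : ℝ) ∂ρ :=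
        integral_mono (integrable_of_mem_Icc_zero_one hf h) (integrable_const _) fun x => (h x).2
    _ = 1 := by simp

lemma abs_sub_le_one_of_mem_Icc {a b : ℝ} (ha : a ∈ Set.Icc (0 : ℝ) 1)
    (hb : b ∈ Set.Icc (0 : ℝ) 1) : |a - b| ≤ 1 :=
  abs_le.2 ⟨by linarith [ha.1, hb.2], by linarith [ha.2, hb.1]⟩

lemma IsUnitFunctional.measurable_updateGap {F : E → (Fin (n + 1) → E) → ℝ}
    {F' : E → (Fin n → E) → ℝ} (hF : IsUnitFunctional F) (hF' : IsUnitFunctional F') :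
    Measurable (updateGap F F') := by
  have h1 : Measurable fun q : E × E × (Fin n → E) => (Fin.cons q.2.1 q.2.2 : Fin (n + 1) → E) :=
    measurable_fin_cons (by fun_prop) (by fun_prop)
  have h2 := hF.measurable.comp ((measurable_fst (α := E) (β := E × (Fin n → E))).prodMk h1)
  have h3 : Measurable fun q : E × E × (Fin n → E) => F' q.1 q.2.2 :=
    hF'.measurable.comp (by fun_prop : Measurable fun q : E × E × (Fin n → E) => (q.1, q.2.2))
  exact continuous_abs.measurable.comp (h2.sub h3)

lemma measurable_integral_left {X : Type*} [MeasurableSpace X] {f : E × X → ℝ}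
    (hf : Measurable f) : Measurable fun x => ∫ z, f (z, x) ∂P :=
  (hf.stronglyMeasurable.integral_prod_left' (μ := P)).measurable

/-- Two swaps of one training observation for another: the deviation of the leave-one-out value is
close to a deviation in which the test point and the training data are independent. -/
lemma IsUnitFunctional.abs_looDeviation_sub_decoupledDeviation_le
    (hF : IsUnitFunctional F) (hF' : IsUnitFunctional F')
    (w z z' : E) (S : Fin n → E) :
    |looDeviation P F F' 0 (Fin.cons z (Fin.cons z' S : Fin (n + 1) → E))
        - decoupledDeviation P F' (w, z, S)| ≤
      updateGap F F' (z, w, Fin.cons z' S) + updateGap F F' (z, z', Fin.cons w S)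
      + (∫ q, updateGap F F' (q, z, Fin.cons z' S) ∂P
        + ∫ q, updateGap F F' (q, w, Fin.cons z' S) ∂P
        + ∫ q, updateGap F F' (q, z', Fin.cons w S) ∂P) := by
  have hsw : ∀ (x a b : E), F x (Fin.cons a (Fin.cons b S : Fin (n + 1) → E)) =
      F x (Fin.cons b (Fin.cons a S : Fin (n + 1) → E)) := fun x a b => by
    rw [cons_cons_eq_comp_swap, hF.symm]
  have hgm := hF.measurable_updateGap hF'
  have hgi : ∀ a R, Integrable (fun q => updateGap F F' (q, a, R)) P := fun a R =>
    integrable_of_abs_le_one (hgm.comp (by fun_prop)) fun q => by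
      simp only [updateGap, abs_abs]
      exact abs_sub_le_one_of_mem_Icc (hF.mem_Icc _ _) (hF'.mem_Icc _ _)
  have hgi2 : ∀ a R b R', Integrable
      (fun q => updateGap F F' (q, a, R) + updateGap F F' (q, b, R')) P := fun a R b R' =>
    (hgi a R).add (hgi b R')
  have hFi : ∀ T, Integrable (fun q => F q T) P := fun T =>
    integrable_of_mem_Icc_zero_one (hF.measurable_left T)
      fun q => hF.mem_Icc _ _
  have hFi' : ∀ T, Integrable (fun q => F' q T) P := fun T =>
    integrable_of_mem_Icc_zero_one (hF'.measurable_left T)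
      fun q => hF'.mem_Icc _ _
  have h1 : |F' z (Fin.cons z' S) - F' z (Fin.cons w S)| ≤
      updateGap F F' (z, w, Fin.cons z' S) + updateGap F F' (z, z', Fin.cons w S) := by
    simp only [updateGap]
    rw [hsw z w z', abs_sub_comm (F z _) (F' z (Fin.cons z' S : Fin (n + 1) → E))]
    exact abs_sub_le _ _ _
  have h2 : |∫ q, F q (Fin.cons z (Fin.cons z' S : Fin (n + 1) → E)) ∂P
      - ∫ q, F' q (Fin.cons w S) ∂P| ≤
      ∫ q, updateGap F F' (q, z, Fin.cons z' S) ∂P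
        + ∫ q, updateGap F F' (q, w, Fin.cons z' S) ∂P
        + ∫ q, updateGap F F' (q, z', Fin.cons w S) ∂P := by
    rw [← integral_sub (hFi _) (hFi' _), ← integral_add (hgi _ _) (hgi _ _),
      ← integral_add (hgi2 _ _ _ _) (hgi _ _)]
    refine abs_integral_le_integral_abs.trans (integral_mono ((hFi _).sub (hFi' _)).abs
      ((hgi2 _ _ _ _).add (hgi _ _)) fun q => ?_)
    simp only [updateGap]
    rw [hsw q w z', abs_sub_comm (F q (Fin.cons z' (Fin.cons w S : Fin (n + 1) → E)))
      (F' q (Fin.cons z' S : Fin (n + 1) → E))]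
    have := abs_sub_le (F q (Fin.cons z (Fin.cons z' S : Fin (n + 1) → E)))
      (F' q (Fin.cons z' S : Fin (n + 1) → E)) (F' q (Fin.cons w S : Fin (n + 1) → E))
    have := abs_sub_le (F' q (Fin.cons z' S : Fin (n + 1) → E))
      (F q (Fin.cons z' (Fin.cons w S : Fin (n + 1) → E))) (F' q (Fin.cons w S : Fin (n + 1) → E))
    linarith
  have h3 : looDeviation P F F' 0 (Fin.cons z (Fin.cons z' S : Fin (n + 1) → E))
        - decoupledDeviation P F' (w, z, S) =
      (F' z (Fin.cons z' S) - F' z (Fin.cons w S)) -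
      (∫ q, F q (Fin.cons z (Fin.cons z' S : Fin (n + 1) → E)) ∂P
      - ∫ q, F' q (Fin.cons w S) ∂P) := by
    simp only [looDeviation, decoupledDeviation, Fin.cons_zero, Fin.removeNth_zero, Fin.tail_cons]
    ring
  rw [h3]
  exact (abs_sub _ _).trans (add_le_add h1 h2)


lemma IsUnitFunctional.measurable_looDeviation (hF : IsUnitFunctional F)
    (hF' : IsUnitFunctional F') (i : Fin (n + 2)) : Measurable (looDeviation P F F' i) :=
  (hF'.measurable.comp (measurePreserving_removeNth P i).measurable).sub
    (measurable_integral_left P hF.measurable)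

lemma IsUnitFunctional.abs_looDeviation_le_one (hF : IsUnitFunctional F)
    (hF' : IsUnitFunctional F') (i : Fin (n + 2)) (T : Fin (n + 2) → E) :
    |looDeviation P F F' i T| ≤ 1 :=
  abs_sub_le_one_of_mem_Icc (hF'.mem_Icc _ _) (integral_mem_Icc_zero_one
    (hF.measurable_left T) fun _ => hF.mem_Icc _ _)

lemma IsUnitFunctional.measurable_decoupledDeviation (hF' : IsUnitFunctional F') :
    Measurable (decoupledDeviation P (n := n) F') := by
  have h1 : Measurable fun q : E × E × (Fin n → E) => (Fin.cons q.1 q.2.2 : Fin (n + 1) → E) :=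
    measurable_fin_cons (by fun_prop) (by fun_prop)
  exact (hF'.measurable.comp
    ((by fun_prop : Measurable fun q : E × E × (Fin n → E) => q.2.1).prodMk h1)).sub
    ((measurable_integral_left P hF'.measurable).comp h1)

lemma IsUnitFunctional.abs_decoupledDeviation_le_one (hF' : IsUnitFunctional F')
    (q : E × E × (Fin n → E)) : |decoupledDeviation P F' q| ≤ 1 :=
  abs_sub_le_one_of_mem_Icc (hF'.mem_Icc _ _) (integral_mem_Icc_zero_one
    (hF'.measurable_left _) fun _ => hF'.mem_Icc _ _)

/-- The five error terms of the pointwise bound have equal means, since the observations are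
exchangeable. -/
lemma IsUnitFunctional.integral_abs_looDeviation_sub_decoupledDeviation_le
    (hF : IsUnitFunctional F) (hF' : IsUnitFunctional F') :
    ∫ q : E × E × E × (Fin n → E),
      |looDeviation P F F' 0 (Fin.cons q.2.1 (Fin.cons q.2.2.1 q.2.2.2 : Fin (n + 1) → E))
        - decoupledDeviation P F' (q.1, q.2.1, q.2.2.2)|
        ∂(P.prod (P.prod (P.prod (Measure.pi fun _ => P)))) ≤
      5 * ∫ q, updateGap F F' q ∂(P.prod (P.prod (Measure.pi fun _ => P))) := by
  set ρ : Measure (Fin n → E) := Measure.pi fun _ => P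
  set η := ∫ q, updateGap F F' q ∂(P.prod (P.prod (Measure.pi fun _ => P)))
  set π := P.prod (P.prod (P.prod ρ))
  have hgm := hF.measurable_updateGap hF'
  have hg1 : ∀ q, |updateGap F F' q| ≤ 1 := fun q => by
    simpa [updateGap] using abs_sub_le_one_of_mem_Icc (hF.mem_Icc _ _) (hF'.mem_Icc _ _)
  -- `(z, w, z', S) ↦ (z, w, cons z' S)` preserves the product measures
  have hmp : MeasurePreserving (fun q : E × E × E × (Fin n → E) =>
      (q.1, q.2.1, (Fin.cons q.2.2.1 q.2.2.2 : Fin (n + 1) → E))) π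
      (P.prod (P.prod (Measure.pi fun _ => P))) :=
    (MeasurePreserving.id P).prod ((MeasurePreserving.id P).prod (measurePreserving_cons P n))
  have hs12 : MeasurePreserving (fun q : E × E × E × (Fin n → E) =>
      (q.2.1, q.1, q.2.2)) π π := measurePreserving_swap_fst P (P.prod ρ)
  have hs23 : MeasurePreserving (fun q : E × E × E × (Fin n → E) =>
      (q.1, q.2.2.1, q.2.1, q.2.2.2)) π π :=
    (MeasurePreserving.id P).prod (measurePreserving_swap_fst P ρ)
  have key : ∀ φ : E × E × E × (Fin n → E) → E × E × (Fin (n + 1) → E),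
      MeasurePreserving φ π (P.prod (P.prod (Measure.pi fun _ => P))) →
      ∫ q, updateGap F F' (φ q) ∂π = η := fun φ hφ => by
    exact hφ.integral_comp_of_measurable hgm
  -- averaging over the test point first
  have hbar : ∀ φ : E × E × E × (Fin n → E) → E × (Fin (n + 1) → E),
      MeasurePreserving φ π (P.prod (Measure.pi fun _ => P)) →
      ∫ q, (∫ x, updateGap F F' (x, φ q) ∂P) ∂π = η := fun φ hφ => by
    have hm := measurable_integral_left P hgm
    rw [← integral_map (f := fun r => ∫ x, updateGap F F' (x, r) ∂P) hφ.measurable.aemeasurable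
      hm.aestronglyMeasurable, hφ.map_eq]
    exact (integral_prod_symm _ (integrable_of_abs_le_one hgm hg1)).symm
  have hsnd : MeasurePreserving (fun q : E × E × E × (Fin n → E) =>
      (q.2.1, (Fin.cons q.2.2.1 q.2.2.2 : Fin (n + 1) → E))) π
      (P.prod (Measure.pi fun _ => P)) := measurePreserving_snd.comp hmp
  have hsk : MeasurePreserving (fun q : E × E × E × (Fin n → E) =>
      (q.1, (Fin.cons q.2.2.1 q.2.2.2 : Fin (n + 1) → E))) π
      (P.prod (Measure.pi fun _ => P)) := hsnd.comp hs12
  have hsl : MeasurePreserving (fun q : E × E × E × (Fin n → E) =>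
      (q.2.2.1, (Fin.cons q.1 q.2.2.2 : Fin (n + 1) → E))) π
      (P.prod (Measure.pi fun _ => P)) := hsnd.comp (hs23.comp hs12)
  have e1 := key _ (hmp.comp hs12)
  have e2 := key _ (hmp.comp (hs23.comp hs12))
  have e3 := hbar _ hsnd
  have e4 := hbar _ hsk
  have e5 := hbar _ hsl
  have i1 : ∀ φ : E × E × E × (Fin n → E) → E × E × (Fin (n + 1) → E), Measurable φ →
      Integrable (fun q => updateGap F F' (φ q)) π := fun φ hφ =>
    integrable_of_abs_le_one (hgm.comp hφ) fun _ => hg1 _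
  have i2 : ∀ φ : E × E × E × (Fin n → E) → E × (Fin (n + 1) → E), Measurable φ →
      Integrable (fun q => ∫ x, updateGap F F' (x, φ q) ∂P) π := fun φ hφ =>
    integrable_of_mem_Icc_zero_one ((measurable_integral_left P hgm).comp hφ) fun _ =>
      integral_mem_Icc_zero_one (hgm.comp (by fun_prop)) fun _ =>
        ⟨abs_nonneg _, le_of_abs_le (hg1 _)⟩
  have j1 := i1 _ (hmp.comp hs12).measurable
  have j2 := i1 _ (hmp.comp (hs23.comp hs12)).measurable
  have j3 := i2 _ hsnd.measurable
  have j4 := i2 _ hsk.measurable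
  have j5 := i2 _ hsl.measurable
  calc _ ≤ ∫ q, ((updateGap F F' (q.2.1, q.1, Fin.cons q.2.2.1 q.2.2.2)
          + updateGap F F' (q.2.1, q.2.2.1, Fin.cons q.1 q.2.2.2))
        + (∫ x, updateGap F F' (x, q.2.1, Fin.cons q.2.2.1 q.2.2.2) ∂P
          + ∫ x, updateGap F F' (x, q.1, Fin.cons q.2.2.1 q.2.2.2) ∂P
          + ∫ x, updateGap F F' (x, q.2.2.1, Fin.cons q.1 q.2.2.2) ∂P)) ∂π := by
        refine integral_mono_of_nonneg (ae_of_all _ fun _ => abs_nonneg _)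
          ((j1.add j2).add ((j3.add j4).add j5)) (ae_of_all _ fun q => ?_)
        exact hF.abs_looDeviation_sub_decoupledDeviation_le P hF' _ _ _ _
    _ = 5 * η := by
        have hadd : ∀ a b c d e : E × E × E × (Fin n → E) → ℝ, Integrable a π → Integrable b π →
            Integrable c π → Integrable d π → Integrable e π →
            ∫ q, ((a q + b q) + (c q + d q + e q)) ∂π =
              (∫ q, a q ∂π + ∫ q, b q ∂π) + (∫ q, c q ∂π + ∫ q, d q ∂π + ∫ q, e q ∂π) := by
          intro a b c d e ha hb hc hd he
          have hab : Integrable (fun q => a q + b q) π := ha.add hb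
          have hcd : Integrable (fun q => c q + d q) π := hc.add hd
          have hcde : Integrable (fun q => c q + d q + e q) π := hcd.add he
          rw [integral_add hab hcde, integral_add ha hb, integral_add hcd he, integral_add hc hd]
        refine (hadd _ _ _ _ _ j1 j2 j3 j4 j5).trans ?_
        rw [e1, e2, e3, e4, e5]
        ring

/-- Conditionally on the training data, deviations at two independent test points are independent
and centred. -/
lemma IsUnitFunctional.integral_decoupledDeviation_mul_eq_zero (hF' : IsUnitFunctional F') :
    ∫ q : E × E × E × (Fin n → E), decoupledDeviation P F' (q.1, q.2.1, q.2.2.2)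
        * decoupledDeviation P F' (q.1, q.2.2.1, q.2.2.2)
        ∂(P.prod (P.prod (P.prod (Measure.pi fun _ => P)))) = 0 := by
  set ρ : Measure (Fin n → E) := Measure.pi fun _ => P
  set π := P.prod (P.prod (P.prod ρ))
  have hs12 : MeasurePreserving (fun q : E × E × E × (Fin n → E) =>
      (q.2.1, q.1, q.2.2)) π π := measurePreserving_swap_fst P (P.prod ρ)
  have hm := hF'.measurable_decoupledDeviation P
  have hb := hF'.abs_decoupledDeviation_le_one P
  let f : E × E × E × (Fin n → E) → ℝ := fun q => decoupledDeviation P F' (q.2.1, q.1, q.2.2.2)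
        * decoupledDeviation P F' (q.2.1, q.2.2.1, q.2.2.2)
  have hfm : Measurable f := (hm.comp (by fun_prop)).mul (hm.comp (by fun_prop))
  have hfi : Integrable f π := integrable_of_abs_le_one hfm fun q => by
    rw [abs_mul]; exact mul_le_one₀ (hb _) (abs_nonneg _) (hb _)
  have h1 : ∫ q, f (q.2.1, q.1, q.2.2) ∂π = ∫ q, f q ∂π := by
    rw [← integral_map hs12.measurable.aemeasurable hfm.aestronglyMeasurable, hs12.map_eq]
  refine h1.trans ?_
  rw [integral_prod_symm _ hfi]
  refine integral_eq_zero_of_ae (ae_of_all _ fun r => ?_)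
  simp only [f, integral_mul_const]
  have : ∫ x, decoupledDeviation P F' (r.1, x, r.2.2) ∂P = 0 := by
    simp only [decoupledDeviation]
    rw [integral_sub (integrable_of_mem_Icc_zero_one (hF'.measurable_left _)
      fun _ => hF'.mem_Icc _ _) (integrable_const _)]
    simp
  simp [this]

/-- Both factors may be replaced by their decoupled versions, whose product has mean zero. Each
replacement costs five update gaps. -/
lemma IsUnitFunctional.integral_looDeviation_zero_mul_one_le (hF : IsUnitFunctional F)
    (hF' : IsUnitFunctional F') :
    ∫ T, looDeviation P F F' 0 T * looDeviation P F F' 1 T ∂(Measure.pi fun _ => P) ≤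
      10 * ∫ q, updateGap F F' q ∂(P.prod (P.prod (Measure.pi fun _ => P))) := by
  set ρ : Measure (Fin n → E) := Measure.pi fun _ => P
  set π := P.prod (P.prod (P.prod ρ))
  set ρ2 : Measure (Fin (n + 2) → E) := Measure.pi fun _ => P
  have hs23 : MeasurePreserving (fun q : E × E × E × (Fin n → E) =>
      (q.1, q.2.2.1, q.2.1, q.2.2.2)) π π :=
    (MeasurePreserving.id P).prod (measurePreserving_swap_fst P ρ)
  have hT : MeasurePreserving (fun q : E × E × E × (Fin n → E) =>
      (Fin.cons q.2.1 (Fin.cons q.2.2.1 q.2.2.2 : Fin (n + 1) → E) : Fin (n + 2) → E)) π ρ2 :=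
    (measurePreserving_cons P (n + 1)).comp
      (((MeasurePreserving.id P).prod (measurePreserving_cons P n)).comp measurePreserving_snd)
  have hm := hF'.measurable_decoupledDeviation P
  have hb := hF'.abs_decoupledDeviation_le_one P
  have hlm := hF.measurable_looDeviation P hF'
  have hlb := hF.abs_looDeviation_le_one P hF'
  let d0 : E × E × E × (Fin n → E) → ℝ := fun q =>
    looDeviation P F F' 0 (Fin.cons q.2.1 (Fin.cons q.2.2.1 q.2.2.2 : Fin (n + 1) → E))
  let d1 : E × E × E × (Fin n → E) → ℝ := fun q =>
    looDeviation P F F' 1 (Fin.cons q.2.1 (Fin.cons q.2.2.1 q.2.2.2 : Fin (n + 1) → E))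
  let b0 : E × E × E × (Fin n → E) → ℝ := fun q =>
    decoupledDeviation P F' (q.1, q.2.1, q.2.2.2)
  let b1 : E × E × E × (Fin n → E) → ℝ := fun q =>
    decoupledDeviation P F' (q.1, q.2.2.1, q.2.2.2)
  have md0 : Measurable d0 := (hlm 0).comp hT.measurable
  have md1 : Measurable d1 := (hlm 1).comp hT.measurable
  have mb0 : Measurable b0 := hm.comp (by fun_prop)
  have mb1 : Measurable b1 := hm.comp (by fun_prop)
  have hd1 : ∀ q, d1 q = d0 (q.1, q.2.2.1, q.2.1, q.2.2.2) := fun q => by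
    simp only [d0, d1]
    rw [cons_cons_eq_comp_swap, hF.looDeviation_comp_perm P hF', Equiv.swap_apply_right]
  have hprod : ∀ f g : E × E × E × (Fin n → E) → ℝ, Measurable f → Measurable g →
      (∀ q, |f q| ≤ 1) → (∀ q, |g q| ≤ 1) → Integrable (fun q => f q * g q) π :=
    fun f g hf hg h1 h2 => integrable_of_abs_le_one (hf.mul hg) fun q => by
      rw [abs_mul]; exact mul_le_one₀ (h1 _) (abs_nonneg _) (h2 _)
  have hsub : ∀ f g : E × E × E × (Fin n → E) → ℝ, Measurable f → Measurable g →
      (∀ q, |f q| ≤ 1) → (∀ q, |g q| ≤ 1) → Integrable (fun q => |f q - g q|) π :=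
    fun f g hf hg h1 h2 => ((Integrable.of_bound hf.aestronglyMeasurable 1 (ae_of_all _ h1)).sub
      (Integrable.of_bound hg.aestronglyMeasurable 1 (ae_of_all _ h2))).abs
  have h0 : ∫ q, |d0 q - b0 q| ∂π ≤ 5 * _ :=
    hF.integral_abs_looDeviation_sub_decoupledDeviation_le P hF'
  have h1 : ∫ q, |d1 q - b1 q| ∂π = ∫ q, |d0 q - b0 q| ∂π := by
    simp only [hd1]
    exact hs23.integral_comp_of_measurable (f := fun q => |d0 q - b0 q|)
      (continuous_abs.measurable.comp (md0.sub mb0))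
  have hz : ∫ q, b0 q * b1 q ∂π = 0 := hF'.integral_decoupledDeviation_mul_eq_zero P
  have hd : ∫ T, looDeviation P F F' 0 T * looDeviation P F F' 1 T ∂ρ2 = ∫ q, d0 q * d1 q ∂π :=
    (hT.integral_comp_of_measurable ((hlm 0).mul (hlm 1))).symm
  have hbd : ∫ q, d0 q * d1 q ∂π ≤
      ∫ q, (b0 q * b1 q + (|d0 q - b0 q| + |d1 q - b1 q|)) ∂π := by
    refine integral_mono (hprod _ _ md0 md1 (fun _ => hlb _ _) fun _ => hlb _ _)
      ((hprod _ _ mb0 mb1 (fun _ => hb _) fun _ => hb _).add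
        ((hsub _ _ md0 mb0 (fun _ => hlb _ _) fun _ => hb _).add
          (hsub _ _ md1 mb1 (fun _ => hlb _ _) fun _ => hb _))) fun q => ?_
    have e : d0 q * d1 q = b0 q * b1 q + ((d0 q - b0 q) * d1 q + b0 q * (d1 q - b1 q)) := by ring
    have a1 : (d0 q - b0 q) * d1 q ≤ |d0 q - b0 q| := by
      refine (le_abs_self _).trans ?_
      rw [abs_mul]
      exact mul_le_of_le_one_right (abs_nonneg _) (hlb _ _)
    have a2 : b0 q * (d1 q - b1 q) ≤ |d1 q - b1 q| := by
      refine (le_abs_self _).trans ?_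
      rw [abs_mul]
      exact mul_le_of_le_one_left (abs_nonneg _) (hb _)
    simp only
    linarith
  have hsum : Integrable (fun q => |d0 q - b0 q| + |d1 q - b1 q|) π :=
    (hsub _ _ md0 mb0 (fun _ => hlb _ _) fun _ => hb _).add
      (hsub _ _ md1 mb1 (fun _ => hlb _ _) fun _ => hb _)
  rw [integral_add (hprod _ _ mb0 mb1 (fun _ => hb _) fun _ => hb _) hsum,
    integral_add (hsub _ _ md0 mb0 (fun _ => hlb _ _) fun _ => hb _)
          (hsub _ _ md1 mb1 (fun _ => hlb _ _) fun _ => hb _), hz, h1] at hbd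
  refine hd.trans_le (hbd.trans ?_)
  linarith

/-- The average of the leave-one-out values concentrates, in mean square, around the mean value of
the full-sample functional at an independent test point, as soon as the addition of one training
observation hardly changes the functional. -/
theorem IsUnitFunctional.integral_sq_average_sub_integral_le (hF : IsUnitFunctional F)
    (hF' : IsUnitFunctional F') :
    ∫ T : Fin (n + 2) → E, ((1 / ((n + 2 : ℕ) : ℝ)) * ∑ i, F' (T i) (i.removeNth T)
        - ∫ z, F z T ∂P) ^ 2 ∂(Measure.pi fun _ => P) ≤
      1 / ((n + 2 : ℕ) : ℝ)
        + 10 * ∫ q, updateGap F F' q ∂(P.prod (P.prod (Measure.pi fun _ => P))) := by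
  set N : ℝ := ((n + 2 : ℕ) : ℝ) with hN
  have hN0 : 0 < N := by positivity
  set ρ : Measure (Fin (n + 2) → E) := Measure.pi fun _ => P
  set η := ∫ q, updateGap F F' q ∂(P.prod (P.prod (Measure.pi fun _ => P)))
  have hη : 0 ≤ η := integral_nonneg fun _ => abs_nonneg _
  have hlm := hF.measurable_looDeviation P hF'
  have hlb := hF.abs_looDeviation_le_one P hF'
  have hint : ∀ i j, Integrable (fun T => looDeviation P F F' i T * looDeviation P F F' j T) ρ :=
    fun i j => integrable_of_abs_le_one ((hlm i).mul (hlm j)) fun T => by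
      rw [abs_mul]; exact mul_le_one₀ (hlb _ _) (abs_nonneg _) (hlb _ _)
  have hoff : ∀ i j, i ≠ j →
      ∫ T, looDeviation P F F' i T * looDeviation P F F' j T ∂ρ ≤ 10 * η := by
    intro i j hij
    -- a permutation carries the pair `(0, 1)` to `(i, j)`
    obtain ⟨σ, h0, h1⟩ : ∃ σ : Equiv.Perm (Fin (n + 2)), σ 0 = i ∧ σ 1 = j := by
      refine ⟨Equiv.swap (Equiv.swap 0 i 1) j * Equiv.swap 0 i, ?_, ?_⟩
      · rw [Equiv.Perm.mul_apply, Equiv.swap_apply_left, Equiv.swap_apply_of_ne_of_ne _ hij]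
        intro h
        have := (Equiv.swap (0 : Fin (n + 2)) i).injective
          ((Equiv.swap_apply_left (0 : Fin (n + 2)) i).trans h)
        exact absurd this (by simp)
      · rw [Equiv.Perm.mul_apply, Equiv.swap_apply_left]
    have hp := measurePreserving_comp_perm P σ
    refine le_of_eq_of_le ?_ (hF.integral_looDeviation_zero_mul_one_le P hF')
    refine Eq.trans ?_ (hp.integral_comp_of_measurable ((hlm 0).mul (hlm 1)))
    simp only [hF.looDeviation_comp_perm P hF', h0, h1]
    rfl
  have hdiag : ∀ i, ∫ T, looDeviation P F F' i T * looDeviation P F F' i T ∂ρ ≤ 1 := fun i => by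
    refine (integral_mono (hint i i) (integrable_const 1) fun T => ?_).trans_eq (by simp)
    calc _ ≤ |looDeviation P F F' i T * looDeviation P F F' i T| := le_abs_self _
      _ ≤ 1 := by rw [abs_mul]; exact mul_le_one₀ (hlb _ _) (abs_nonneg _) (hlb _ _)
  have hexp : ∀ T : Fin (n + 2) → E, ((1 / N) * ∑ i, F' (T i) (i.removeNth T)
        - ∫ z, F z T ∂P) ^ 2 = (1 / N ^ 2) *
        ∑ i, ∑ j, looDeviation P F F' i T * looDeviation P F F' j T := fun T => by
    have : (1 / N) * ∑ i, F' (T i) (i.removeNth T) - ∫ z, F z T ∂P =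
        (1 / N) * ∑ i, looDeviation P F F' i T := by
      simp only [looDeviation, Finset.sum_sub_distrib, Finset.sum_const, Finset.card_univ,
        Fintype.card_fin, nsmul_eq_mul, ← hN]
      field_simp
    rw [this, mul_pow, sq (∑ i, looDeviation P F F' i T), Finset.sum_mul_sum]
    ring
  simp only [hexp]
  rw [integral_const_mul,
    integral_finsetSum _ fun i _ => integrable_finsetSum _ fun j _ => hint i j]
  have hrow : ∀ i, ∫ T, ∑ j, looDeviation P F F' i T * looDeviation P F F' j T ∂ρ ≤
      1 + N * (10 * η) := fun i => by
    rw [integral_finsetSum _ fun j _ => hint i j]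
    calc _ ≤ ∑ j, ((if i = j then (1 : ℝ) else 0) + 10 * η) := by
          refine Finset.sum_le_sum fun j _ => ?_
          split_ifs with h
          · subst h
            linarith [hdiag i]
          · linarith [hoff i j h]
      _ = _ := by
          rw [Finset.sum_add_distrib, Finset.sum_ite_eq, Finset.sum_const, Finset.card_univ,
            Fintype.card_fin, nsmul_eq_mul, if_pos (Finset.mem_univ _)]
  calc _ ≤ 1 / N ^ 2 * ∑ _i : Fin (n + 2), (1 + N * (10 * η)) := by
        gcongr with i _
        exact hrow i
    _ = _ := by
        simp only [Finset.sum_const, Finset.card_univ, Fintype.card_fin, nsmul_eq_mul, ← hN]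
        field_simp

end Concentration

/-! ### Quantiles, coverage and Lévy closeness -/

section Quantile

lemma quantile_zero_eq_bot {F : ℝ → ℝ} (hF : ∀ t, 0 ≤ F t) : quantile F 0 = ⊥ := by
  refine (EReal.eq_bot_iff_forall_lt _).2 fun y => ?_
  have : quantile F 0 ≤ ((y - 1 : ℝ) : EReal) := sInf_le ⟨y - 1, hF _, rfl⟩
  exact this.trans_lt (by exact_mod_cast sub_one_lt y)

lemma quantile_le {F : ℝ → ℝ} {α t : ℝ} (h : α ≤ F t) : quantile F α ≤ t :=
  sInf_le ⟨t, h, rfl⟩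

lemma le_quantile {F : ℝ → ℝ} (hF : Monotone F) {α t : ℝ} (h : F t < α) :
    (t : EReal) ≤ quantile F α := by
  refine le_sInf ?_
  rintro _ ⟨x, hx, rfl⟩
  exact EReal.coe_le_coe_iff.2 (hF.reflect_lt (h.trans_le hx)).le

/-- A quantile of positive level is a real number. -/
lemma exists_quantile_eq_coe {F : ℝ → ℝ} (hF : Monotone F) {α t₀ t₁ : ℝ} (h₀ : F t₀ < α)
    (h₁ : α ≤ F t₁) :
    ∃ q : ℝ, quantile F α = q ∧ (∀ t, q < t → α ≤ F t) ∧ ∀ t, t < q → F t < α := by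
  have hlo := le_quantile hF h₀
  have hhi := quantile_le h₁
  lift quantile F α to ℝ using
    ⟨(hhi.trans_lt (EReal.coe_lt_top _)).ne, ((EReal.bot_lt_coe _).trans_le hlo).ne'⟩ with q hq
  refine ⟨q, rfl, fun t ht => ?_, fun t ht => ?_⟩
  · have : quantile F α < (t : EReal) := by rw [← hq]; exact_mod_cast ht
    obtain ⟨_, ⟨x, hx, rfl⟩, hxt⟩ := sInf_lt_iff.1 this
    exact le_trans hx (hF (EReal.coe_le_coe_iff.1 hxt.le))
  · by_contra! h
    have := quantile_le h
    rw [← hq] at this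
    exact absurd ht (not_lt.2 (by exact_mod_cast this))

end Quantile

section Coverage

variable {p n : ℕ} (A : PredictionAlgorithm)

lemma jackknifeCDF_mono (T : Fin (n + 1) → Obs p) : Monotone (jackknifeCDF A T) := by
  intro s t hst
  unfold jackknifeCDF
  gcongr with i _
  split_ifs with h1 h2 <;> first | exact absurd (h1.trans hst) h2 | norm_num

lemma jackknifeCDF_nonneg (T : Fin (n + 1) → Obs p) (t : ℝ) : 0 ≤ jackknifeCDF A T t := by
  unfold jackknifeCDF
  refine mul_nonneg (by positivity) (Finset.sum_nonneg fun i _ => ?_)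
  split_ifs <;> norm_num

lemma jackknifeCDF_le_one (T : Fin (n + 1) → Obs p) (t : ℝ) : jackknifeCDF A T t ≤ 1 := by
  unfold jackknifeCDF
  calc _ ≤ (1 / ((n + 1 : ℕ) : ℝ)) * ∑ _i : Fin (n + 1), (1 : ℝ) := by
        gcongr with i _
        split_ifs <;> norm_num
    _ = 1 := by
        simp only [Finset.sum_const, Finset.card_univ, Fintype.card_fin, nsmul_eq_mul]
        field_simp

lemma exists_jackknifeCDF_eq_zero (T : Fin (n + 1) → Obs p) : ∃ t, jackknifeCDF A T t = 0 := by
  obtain ⟨t, ht⟩ := (Set.finite_range (looResidual A T)).bddBelow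
  refine ⟨t - 1, ?_⟩
  unfold jackknifeCDF
  rw [Finset.sum_eq_zero fun i _ => if_neg ?_, mul_zero]
  have := ht ⟨i, rfl⟩
  linarith

lemma exists_jackknifeCDF_eq_one (T : Fin (n + 1) → Obs p) : ∃ t, jackknifeCDF A T t = 1 := by
  obtain ⟨t, ht⟩ := (Set.finite_range (looResidual A T)).bddAbove
  refine ⟨t, ?_⟩
  unfold jackknifeCDF
  rw [Finset.sum_congr rfl fun i _ => if_pos (ht ⟨i, rfl⟩)]
  simp only [Finset.sum_const, Finset.card_univ, Fintype.card_fin, nsmul_eq_mul]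
  field_simp

/-- The distribution function of the prediction error at a new observation with law `P`, for fixed
training data. -/
noncomputable def errorCDF (P : Measure (Obs p)) (T : Fin (n + 1) → Obs p) (t : ℝ) : ℝ :=
  P.real {z | z.1 - A p (n + 1) z.2 T ≤ t}

variable {A} (P : Measure (Obs p)) [IsProbabilityMeasure P]

lemma errorCDF_mono (T : Fin (n + 1) → Obs p) : Monotone (errorCDF A P T) := fun _ _ hst =>
  measureReal_mono fun _ hz => le_trans hz hst

/-- If the empirical distribution of the leave-one-out residuals and the distribution of the
prediction error are close in the Lévy sense, the intervals cover at almost their nominal rate,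
at all levels. -/
lemma coverage_ge_of_levy_close {T : Fin (n + 1) → Obs p} {δ ε : ℝ} (hε : 0 < ε)
    (h1 : ∀ t, jackknifeCDF A T t ≤ errorCDF A P T (t + δ / 2) + ε)
    (h2 : ∀ t, errorCDF A P T t ≤ jackknifeCDF A T (t + δ / 2) + ε) (hδ : 0 < δ)
    {α₁ α₂ : ℝ} (ha : 0 ≤ α₁) (hab : α₁ ≤ α₂) (hb : α₂ ≤ 1) :
    -(2 * ε) ≤ P.real {z : Obs p | z.1 ∈ jackknifePI A α₁ α₂ δ z.2 T} - (α₂ - α₁) := by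
  have hmono := jackknifeCDF_mono A T
  obtain ⟨t₀, ht₀⟩ := exists_jackknifeCDF_eq_zero A T
  obtain ⟨t₁, ht₁⟩ := exists_jackknifeCDF_eq_one A T
  -- the quantile is `-∞` at level zero; for `α₂ = 0` the nominal rate is zero
  rcases (ha.trans hab).eq_or_lt with h0 | h0
  · have : (0 : ℝ) ≤ P.real {z : Obs p | z.1 ∈ jackknifePI A α₁ α₂ δ z.2 T} := measureReal_nonneg
    linarith
  obtain ⟨q₂, hq₂, hgt, -⟩ := exists_quantile_eq_coe hmono (ht₀ ▸ h0) (ht₁ ▸ hb)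
  have hup : α₂ ≤ errorCDF A P T (q₂ + δ) + ε := by
    have := (hgt (q₂ + δ / 2) (by linarith)).trans (h1 _)
    rwa [add_assoc, add_halves] at this
  rcases ha.eq_or_lt with h | h
  · have hsub : {z : Obs p | z.1 - A p (n + 1) z.2 T ≤ q₂ + δ} ⊆
        {z : Obs p | z.1 ∈ jackknifePI A α₁ α₂ δ z.2 T} := by
      intro z hz
      simp only [Set.mem_ofPred_eq] at hz
      refine ⟨?_, ?_⟩
      · rw [← h, quantile_zero_eq_bot (jackknifeCDF_nonneg A T), sub_eq_add_neg, EReal.bot_add,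
          EReal.add_bot]
        exact bot_le
      · rw [hq₂]
        exact_mod_cast (by linarith : z.1 ≤ A p (n + 1) z.2 T + (q₂ + δ))
    have := measureReal_mono (μ := P) hsub
    rw [errorCDF] at hup
    linarith
  · obtain ⟨q₁, hq₁, -, hlt⟩ := exists_quantile_eq_coe hmono (ht₀ ▸ h) (ht₁ ▸ hab.trans hb)
    have hlo : errorCDF A P T (q₁ - δ) ≤ α₁ + ε := by
      have e : q₁ - δ + δ / 2 < q₁ := by linarith
      linarith [h2 (q₁ - δ), hlt _ e]
    have hsub : {z : Obs p | z.1 - A p (n + 1) z.2 T ≤ q₂ + δ} ⊆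
        {z : Obs p | z.1 ∈ jackknifePI A α₁ α₂ δ z.2 T} ∪
          {z : Obs p | z.1 - A p (n + 1) z.2 T ≤ q₁ - δ} := by
      intro z hz
      simp only [Set.mem_ofPred_eq] at hz
      rcases le_total (z.1 - A p (n + 1) z.2 T) (q₁ - δ) with h | h
      · exact Or.inr h
      · refine Or.inl ⟨?_, ?_⟩
        · rw [hq₁]
          exact_mod_cast (by linarith : A p (n + 1) z.2 T + (q₁ - δ) ≤ z.1)
        · rw [hq₂]
          exact_mod_cast (by linarith : z.1 ≤ A p (n + 1) z.2 T + (q₂ + δ))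
    have := (measureReal_mono (μ := P) hsub).trans (measureReal_union_le _ _)
    rw [errorCDF] at hup hlo
    linarith

/-- Coverage of the lower half-lines makes the error distribution function at least as large as the
empirical one, up to a shift. -/
lemma jackknifeCDF_le_errorCDF_of_coverage {T : Fin (n + 1) → Obs p} {δ ε : ℝ}
    (h : ∀ α₁ α₂, 0 ≤ α₁ → α₁ ≤ α₂ → α₂ ≤ 1 →
      -ε ≤ P.real {z : Obs p | z.1 ∈ jackknifePI A α₁ α₂ δ z.2 T} - (α₂ - α₁)) (t : ℝ) :
    jackknifeCDF A T t ≤ errorCDF A P T (t + δ) + ε := by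
  -- the quantile of level `jackknifeCDF A T t` is at most `t`
  have h1 := h 0 (jackknifeCDF A T t) le_rfl (jackknifeCDF_nonneg A T t) (jackknifeCDF_le_one A T t)
  have hsub : {z : Obs p | z.1 ∈ jackknifePI A 0 (jackknifeCDF A T t) δ z.2 T} ⊆
      {z : Obs p | z.1 - A p (n + 1) z.2 T ≤ t + δ} := by
    rintro z ⟨-, hz⟩
    have h2 : (z.1 : EReal) ≤ (A p (n + 1) z.2 T : EReal) + ((t : EReal) + (δ : EReal)) :=
      hz.trans (add_le_add le_rfl (add_le_add (quantile_le le_rfl) le_rfl))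
    have h3 : z.1 ≤ A p (n + 1) z.2 T + (t + δ) := by exact_mod_cast h2
    simp only [Set.mem_ofPred_eq]
    linarith
  have := measureReal_mono (μ := P) hsub
  rw [errorCDF]
  linarith

/-- Coverage of the upper half-lines makes the error distribution function at most as large as the
empirical one, up to a shift. -/
lemma errorCDF_le_jackknifeCDF_of_coverage (hA : A.IsMeasurable) {T : Fin (n + 1) → Obs p}
    {δ ε : ℝ} (hε : 0 < ε) (hδ : 0 < δ)
    (h : ∀ α₁ α₂, 0 ≤ α₁ → α₁ ≤ α₂ → α₂ ≤ 1 →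
      -ε ≤ P.real {z : Obs p | z.1 ∈ jackknifePI A α₁ α₂ δ z.2 T} - (α₂ - α₁)) (t : ℝ) :
    errorCDF A P T t ≤ jackknifeCDF A T (t + 2 * δ) + 2 * ε := by
  have hle : errorCDF A P T t ≤ 1 := measureReal_le_one
  rcases le_or_gt 1 (jackknifeCDF A T (t + 2 * δ) + ε) with h1 | h1
  · linarith
  -- a level above the value at `t + 2 * δ` has its quantile to the right of `t + 2 * δ`
  have h2 := h (jackknifeCDF A T (t + 2 * δ) + ε) 1
    (add_nonneg (jackknifeCDF_nonneg A T _) hε.le) h1.le le_rfl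
  have hms : MeasurableSet {z : Obs p | z.1 - A p (n + 1) z.2 T ≤ t} :=
    measurableSet_le (measurable_fst.sub ((hA p (n + 1)).comp
      (by fun_prop : Measurable fun z : Obs p => (z.2, T)))) measurable_const
  have hsub : {z : Obs p | z.1 ∈ jackknifePI A (jackknifeCDF A T (t + 2 * δ) + ε) 1 δ z.2 T} ⊆
      {z : Obs p | z.1 - A p (n + 1) z.2 T ≤ t}ᶜ := by
    rintro z ⟨hz, -⟩
    have hq := le_quantile (jackknifeCDF_mono A T)
      (show jackknifeCDF A T (t + 2 * δ) < jackknifeCDF A T (t + 2 * δ) + ε by linarith)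
    have h3 : (A p (n + 1) z.2 T : EReal) + (((t + 2 * δ : ℝ) : EReal) - (δ : EReal)) ≤ z.1 :=
      (add_le_add le_rfl (EReal.sub_le_sub hq le_rfl)).trans hz
    have h4 : A p (n + 1) z.2 T + (t + 2 * δ - δ) ≤ z.1 := by exact_mod_cast h3
    simp only [Set.mem_compl_iff, Set.mem_ofPred_eq, not_le]
    linarith
  have h5 := measureReal_mono (μ := P) hsub
  rw [probReal_compl_eq_one_sub hms] at h5
  rw [errorCDF]
  linarith

end Coverage

/-! ### Laws of the sample and the conditional mean of the predictor -/

section Sample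

lemma memLp_updateDrift {Ω : Type*} [MeasurableSpace Ω] {μ : Measure Ω} {p n : ℕ}
    {Z : Fin (n + 1 + 1) → Ω → Obs p} {A : PredictionAlgorithm}
    (h : MemLp (predictor A Z) 2 μ) (h' : MemLp (predictorLoo A Z) 2 μ) :
    MemLp (updateDrift A Z μ) 2 μ :=
  (h.condExp one_le_two).sub h'

/-- The full predictor, as a function of the test features, the training data without their last
pair, and that last pair. -/
lemma predictor_eq_snoc {Ω : Type*} {p n : ℕ} {Z : Fin (n + 1 + 1) → Ω → Obs p}
    {A : PredictionAlgorithm} (ω : Ω) : predictor A Z ω =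
    A p (n + 1) (newPair Z ω).2
      (Fin.snoc (α := fun _ => Obs p) (trainingDataLoo Z ω) (trainingData Z ω (Fin.last n))) := by
  have : (Fin.snoc (α := fun _ => Obs p) (trainingDataLoo Z ω) (trainingData Z ω (Fin.last n))) =
      trainingData Z ω := by
    rw [trainingDataLoo, Fin.removeNth_last]
    exact Fin.snoc_init_self _
  rw [this, predictor]

variable {Ω : Type*} [MeasurableSpace Ω] {μ : Measure Ω} [IsProbabilityMeasure μ] {p n : ℕ}
  {P : Measure (Obs p)}

lemma IsIIDSample.isProbabilityMeasure {Z : Fin (n + 1) → Ω → Obs p} (hZ : IsIIDSample Z P μ) :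
    IsProbabilityMeasure P := by
  rw [← hZ.law 0]
  exact Measure.isProbabilityMeasure_map (hZ.measurable 0).aemeasurable

/-- A measurable, independent second component has the same conditional distribution as without
conditioning. -/
lemma condDistrib_ae_eq_const {X Y : Type*} [MeasurableSpace X] [MeasurableSpace Y]
    [StandardBorelSpace Y] [Nonempty Y] {f : Ω → X} {g : Ω → Y} {ρ : Measure X} {ν : Measure Y}
    [IsProbabilityMeasure ρ] [IsProbabilityMeasure ν]
    (h : MeasurePreserving (fun ω => (f ω, g ω)) μ (ρ.prod ν)) :
    ∀ᵐ ω ∂μ, condDistrib g f μ (f ω) = ν := by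
  have hf : MeasurePreserving f μ ρ := measurePreserving_fst.comp h
  have hg : Measurable g := measurable_snd.comp h.measurable
  have := condDistrib_ae_eq_of_measure_eq_compProd_of_measurable (κ := Kernel.const X ν)
    hf.measurable hg (by rw [h.map_eq, hf.map_eq, Measure.compProd_const])
  filter_upwards [ae_of_ae_map hf.measurable.aemeasurable this] with ω hω
  rw [hω, Kernel.const_apply]

lemma IsIIDSample.measurePreserving {N : ℕ} {Z : Fin N → Ω → Obs p} (hZ : IsIIDSample Z P μ) :
    MeasurePreserving (fun ω i => Z i ω) μ (Measure.pi fun _ => P) := by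
  refine ⟨measurable_pi_iff.2 hZ.measurable, ?_⟩
  rw [(iIndepFun_iff_map_fun_eq_pi_map fun i => (hZ.measurable i).aemeasurable).1 hZ.indep]
  simp only [hZ.law]

variable [IsProbabilityMeasure P]

lemma IsIIDSample.measurePreserving_newPair_trainingData {N : ℕ} {Z : Fin (N + 1) → Ω → Obs p}
    (hZ : IsIIDSample Z P μ) :
    MeasurePreserving (fun ω => (newPair Z ω, trainingData Z ω)) μ
      (P.prod (Measure.pi fun _ => P)) := by
  have h := (measurePreserving_removeNth P (Fin.last N)).comp hZ.measurePreserving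
  convert h using 2 with ω
  simp [newPair, Fin.init_def]
  rfl

lemma IsIIDSample.measurePreserving_trainingData {N : ℕ} {Z : Fin (N + 1) → Ω → Obs p}
    (hZ : IsIIDSample Z P μ) :
    MeasurePreserving (trainingData Z) μ (Measure.pi fun _ => P) :=
  measurePreserving_snd.comp hZ.measurePreserving_newPair_trainingData

variable {Z : Fin (n + 1 + 1) → Ω → Obs p}

lemma IsIIDSample.measurePreserving_newPair_lastPair_trainingDataLoo (hZ : IsIIDSample Z P μ) :
    MeasurePreserving
      (fun ω => (newPair Z ω, trainingData Z ω (Fin.last n), trainingDataLoo Z ω)) μ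
      (P.prod (P.prod (Measure.pi fun _ => P))) :=
  ((MeasurePreserving.id P).prod (measurePreserving_removeNth P (Fin.last n))).comp
    hZ.measurePreserving_newPair_trainingData

lemma IsIIDSample.measurePreserving_newPair_trainingDataLoo (hZ : IsIIDSample Z P μ) :
    MeasurePreserving (fun ω => (newPair Z ω, trainingDataLoo Z ω)) μ
      (P.prod (Measure.pi fun _ => P)) :=
  ((MeasurePreserving.id P).prod measurePreserving_snd).comp
    hZ.measurePreserving_newPair_lastPair_trainingDataLoo

variable {A : PredictionAlgorithm}

lemma measurable_predictor (hA : A.IsMeasurable) (hZ : IsIIDSample Z P μ) :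
    Measurable (predictor A Z) := by
  have h := hZ.measurePreserving_newPair_trainingData.measurable
  exact (hA p (n + 1)).comp ((measurable_snd.comp (measurable_fst.comp h)).prodMk
    (measurable_snd.comp h))

lemma measurable_predictorLoo (hA : A.IsMeasurable) (hZ : IsIIDSample Z P μ) :
    Measurable (predictorLoo A Z) := by
  have h := hZ.measurePreserving_newPair_trainingDataLoo.measurable
  exact (hA p n).comp ((measurable_snd.comp (measurable_fst.comp h)).prodMk
    (measurable_snd.comp h))

lemma measurable_fin_snoc {E X : Type*} [MeasurableSpace E] [MeasurableSpace X] {f : X → E}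
    {g : X → Fin n → E} (hg : Measurable g) (hf : Measurable f) :
    Measurable fun x => (Fin.snoc (α := fun _ => E) (g x) (f x) : Fin (n + 1) → E) := by
  refine measurable_pi_iff.2 fun i => ?_
  refine Fin.lastCases ?_ (fun j => ?_) i
  · simpa using hf
  · simpa using measurable_pi_iff.1 hg j

/-- Conditioning on the new response in addition to the new features and the reduced training data
does not change the conditional mean of the predictor: it is an average over the last training
pair, which is independent of all of these. -/
lemma condExp_predictor_comap_newPair (hA : A.IsMeasurable) (hZ : IsIIDSample Z P μ)
    (h : Integrable (predictor A Z) μ) :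
    μ[predictor A Z | MeasurableSpace.comap
        (fun ω => (trainingDataLoo Z ω, newPair Z ω)) inferInstance] =ᵐ[μ]
      μ[predictor A Z | MeasurableSpace.comap
        (fun ω => (trainingDataLoo Z ω, (newPair Z ω).2)) inferInstance] := by
  have h3 := hZ.measurePreserving_newPair_lastPair_trainingDataLoo
  set ρ : Measure (Fin n → Obs p) := Measure.pi fun _ => P
  -- the last training pair is independent of the new pair and the reduced training data
  have hind : MeasurePreserving
      (fun ω => ((trainingDataLoo Z ω, newPair Z ω), trainingData Z ω (Fin.last n))) μ
      ((ρ.prod P).prod P) := by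
    have h1 := (Measure.measurePreserving_swap (μ := P) (ν := P.prod ρ)).comp
      ((measurePreserving_swap_fst P ρ).comp h3)
    exact (((Measure.measurePreserving_swap (μ := P) (ν := ρ)).prod (MeasurePreserving.id P)).comp
      h1)
  set ρ' : Measure ((Fin n → Obs p) × EuclideanSpace ℝ (Fin p)) :=
    (ρ.prod P).map (fun q => (q.1, q.2.2)) with hρ'
  have hm : Measurable fun q : (Fin n → Obs p) × Obs p => (q.1, q.2.2) := by fun_prop
  have : IsProbabilityMeasure ρ' := Measure.isProbabilityMeasure_map hm.aemeasurable
  have hind' : MeasurePreserving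
      (fun ω => ((trainingDataLoo Z ω, (newPair Z ω).2), trainingData Z ω (Fin.last n))) μ
      (ρ'.prod P) :=
    ((hm.measurePreserving (ρ.prod P)).prod (MeasurePreserving.id P)).comp hind
  have hc := condDistrib_ae_eq_const hind
  have hc' := condDistrib_ae_eq_const hind'
  have hφ : Measurable fun q : ((Fin n → Obs p) × EuclideanSpace ℝ (Fin p)) × Obs p =>
      A p (n + 1) q.1.2 (Fin.snoc (α := fun _ => Obs p) q.1.1 q.2) :=
    (hA p (n + 1)).comp ((by fun_prop : Measurable fun q :
      ((Fin n → Obs p) × EuclideanSpace ℝ (Fin p)) × Obs p => q.1.2).prodMk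
        (measurable_fin_snoc (by fun_prop) measurable_snd))
  have heq : predictor A Z = fun ω => A p (n + 1) (newPair Z ω).2
      (Fin.snoc (α := fun _ => Obs p) (trainingDataLoo Z ω) (trainingData Z ω (Fin.last n))) :=
    funext predictor_eq_snoc
  rw [heq] at h ⊢
  have e := condExp_prod_ae_eq_integral_condDistrib
    (X := fun ω => (trainingDataLoo Z ω, newPair Z ω))
    (Y := fun ω => trainingData Z ω (Fin.last n))
    (f := fun q => A p (n + 1) q.1.2.2 (Fin.snoc (α := fun _ => Obs p) q.1.1 q.2))
    (measurable_fst.comp hind.measurable) (measurable_snd.comp hind.measurable).aemeasurable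
    (hφ.comp (by fun_prop : Measurable fun q : ((Fin n → Obs p) × Obs p) × Obs p =>
      ((q.1.1, q.1.2.2), q.2))).stronglyMeasurable h
  have e' := condExp_prod_ae_eq_integral_condDistrib
    (X := fun ω => (trainingDataLoo Z ω, (newPair Z ω).2))
    (Y := fun ω => trainingData Z ω (Fin.last n))
    (f := fun q => A p (n + 1) q.1.2 (Fin.snoc (α := fun _ => Obs p) q.1.1 q.2))
    (measurable_fst.comp hind'.measurable) (measurable_snd.comp hind'.measurable).aemeasurable
    hφ.stronglyMeasurable h
  filter_upwards [e, e', hc, hc'] with ω h1 h2 h3 h4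
  rw [h1, h2, h3, h4]

/-- Against square integrable functions of the new pair and the reduced training data, the update
of the predictor integrates like its drift. -/
lemma integral_mul_update_eq_integral_mul_updateDrift (hA : A.IsMeasurable)
    (hZ : IsIIDSample Z P μ) (h : MemLp (predictor A Z) 2 μ) (h' : MemLp (predictorLoo A Z) 2 μ)
    {g : (Fin n → Obs p) × Obs p → ℝ} (hg : Measurable g)
    (hg2 : MemLp (fun ω => g (trainingDataLoo Z ω, newPair Z ω)) 2 μ) :
    ∫ ω, g (trainingDataLoo Z ω, newPair Z ω) * (predictor A Z ω - predictorLoo A Z ω) ∂μ =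
      ∫ ω, g (trainingDataLoo Z ω, newPair Z ω) * updateDrift A Z μ ω ∂μ := by
  have hX : Measurable fun ω => (trainingDataLoo Z ω, newPair Z ω) :=
    measurable_swap.comp hZ.measurePreserving_newPair_trainingDataLoo.measurable
  set X := fun ω => (trainingDataLoo Z ω, newPair Z ω) with hXdef
  have hi : Integrable (predictor A Z) μ := h.integrable one_le_two
  have hgi : Integrable (fun ω => g (X ω) * predictor A Z ω) μ := hg2.integrable_mul h
  have hgi' : Integrable (fun ω => g (X ω) * predictorLoo A Z ω) μ := hg2.integrable_mul h'
  have hce := h.condExp (m := MeasurableSpace.comap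
        (fun ω => (trainingDataLoo Z ω, (newPair Z ω).2)) inferInstance) one_le_two
  have hgc : Integrable (fun ω => g (X ω) * (μ[predictor A Z | MeasurableSpace.comap
        (fun ω => (trainingDataLoo Z ω, (newPair Z ω).2)) inferInstance]) ω) μ :=
    hg2.integrable_mul hce
  have hsm : StronglyMeasurable[MeasurableSpace.comap X inferInstance] fun ω => g (X ω) :=
    (hg.comp (comap_measurable X)).stronglyMeasurable
  have key : ∫ ω, g (X ω) * predictor A Z ω ∂μ =
      ∫ ω, g (X ω) * (μ[predictor A Z | MeasurableSpace.comap
        (fun ω => (trainingDataLoo Z ω, (newPair Z ω).2)) inferInstance]) ω ∂μ := by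
    rw [← integral_condExp hX.comap_le]
    refine integral_congr_ae ?_
    filter_upwards [condExp_mul_of_stronglyMeasurable_left hsm hgi hi,
      condExp_predictor_comap_newPair hA hZ hi] with ω h1 h2
    refine h1.trans ?_
    rw [Pi.mul_apply, h2]
  simp only [mul_sub, updateDrift]
  rw [integral_sub hgi hgi', integral_sub hgc hgi', key]

end Sample

/-! ### Moments and truncation -/

section Moments

variable {Ω : Type*} [MeasurableSpace Ω] {μ : Measure Ω}

lemma sq_integral_mul_le {f g : Ω → ℝ} (hf : MemLp f 2 μ) (hg : MemLp g 2 μ) :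
    (∫ ω, f ω * g ω ∂μ) ^ 2 ≤ (∫ ω, f ω ^ 2 ∂μ) * ∫ ω, g ω ^ 2 ∂μ := by
  have hfg : Integrable (fun ω => f ω * g ω) μ := hf.integrable_mul hg
  have h : ∀ x : ℝ, 0 ≤ (∫ ω, f ω ^ 2 ∂μ) * (x * x) + (2 * ∫ ω, f ω * g ω ∂μ) * x
      + ∫ ω, g ω ^ 2 ∂μ := fun x => by
    have h1 : Integrable (fun ω => f ω ^ 2 * (x * x)) μ := hf.integrable_sq.mul_const _
    have h2 : Integrable (fun ω => 2 * (f ω * g ω) * x) μ := (hfg.const_mul 2).mul_const x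
    have h12 : Integrable (fun ω => f ω ^ 2 * (x * x) + 2 * (f ω * g ω) * x) μ := h1.add h2
    have : 0 ≤ ∫ ω, (f ω ^ 2 * (x * x) + 2 * (f ω * g ω) * x + g ω ^ 2) ∂μ :=
      integral_nonneg fun ω => by
        have : f ω ^ 2 * (x * x) + 2 * (f ω * g ω) * x + g ω ^ 2 = (f ω * x + g ω) ^ 2 := by ring
        simp only [this]
        positivity
    rwa [integral_add h12 hg.integrable_sq, integral_add h1 h2, integral_mul_const,
      integral_mul_const, integral_const_mul] at this
  have := discrim_le_zero h
  rw [discrim] at this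
  linarith

lemma ofReal_abs_rpow (x : ℝ) {q : ℝ} (hq : 0 ≤ q) : ENNReal.ofReal (|x| ^ q) = ‖x‖ₑ ^ q := by
  rw [Real.enorm_eq_ofReal_abs, ENNReal.ofReal_rpow_of_nonneg (abs_nonneg x) hq]

lemma integrable_abs_rpow_of_lintegral_le {X : Ω → ℝ} (hX : Measurable X) {q : ℝ} (hq : 0 ≤ q)
    {C : ℝ≥0} (h : ∫⁻ ω, ‖X ω‖ₑ ^ q ∂μ ≤ C) :
    Integrable (fun ω => |X ω| ^ q) μ ∧ ∫ ω, |X ω| ^ q ∂μ ≤ C := by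
  have hm : Measurable fun ω => |X ω| ^ q := (continuous_abs.measurable.comp hX).pow_const q
  have h0 : 0 ≤ᵐ[μ] fun ω => |X ω| ^ q := ae_of_all _ fun ω => Real.rpow_nonneg (abs_nonneg _) _
  have he : ∫⁻ ω, ENNReal.ofReal (|X ω| ^ q) ∂μ ≤ C := by simpa only [ofReal_abs_rpow _ hq] using h
  refine ⟨⟨hm.aestronglyMeasurable, ?_⟩, ?_⟩
  · rw [hasFiniteIntegral_iff_ofReal h0]
    exact he.trans_lt ENNReal.coe_lt_top
  · rw [integral_eq_lintegral_of_nonneg_ae h0 hm.aestronglyMeasurable]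
    exact ENNReal.toReal_le_of_le_ofReal C.2 (by simpa using he)

lemma sq_le_one_add_abs_rpow (x : ℝ) {q : ℝ} (hq : 2 ≤ q) : x ^ 2 ≤ 1 + |x| ^ q := by
  have h0 : 0 ≤ |x| ^ q := Real.rpow_nonneg (abs_nonneg _) _
  rcases le_total |x| 1 with h | h
  · have : x ^ 2 ≤ 1 := (sq_le_one_iff_abs_le_one x).2 h
    linarith
  · have := Real.rpow_le_rpow_of_exponent_le h hq
    rw [Real.rpow_two, sq_abs] at this
    linarith

lemma integral_abs_sub_rpow_le {X Y : Ω → ℝ} (hX : Measurable X) (hY : Measurable Y) {q : ℝ}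
    (hq : 0 ≤ q) {C D : ℝ≥0} (hC : ∫⁻ ω, ‖X ω‖ₑ ^ q ∂μ ≤ C) (hD : ∫⁻ ω, ‖Y ω‖ₑ ^ q ∂μ ≤ D) :
    Integrable (fun ω => |X ω - Y ω| ^ q) μ ∧
      ∫ ω, |X ω - Y ω| ^ q ∂μ ≤ 2 ^ q * (C + D) := by
  obtain ⟨h1, h2⟩ := integrable_abs_rpow_of_lintegral_le hX hq hC
  obtain ⟨h3, h4⟩ := integrable_abs_rpow_of_lintegral_le hY hq hD
  have h5 : Integrable (fun ω => 2 ^ q * (|X ω| ^ q + |Y ω| ^ q)) μ := (h1.add h3).const_mul _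
  have hle : ∀ ω, |X ω - Y ω| ^ q ≤ 2 ^ q * (|X ω| ^ q + |Y ω| ^ q) := fun ω => by
    have hx : 0 ≤ |X ω| ^ q := Real.rpow_nonneg (abs_nonneg _) _
    have hy : 0 ≤ |Y ω| ^ q := Real.rpow_nonneg (abs_nonneg _) _
    have hm : |X ω - Y ω| ≤ 2 * max |X ω| |Y ω| := by
      have := abs_sub (X ω) (Y ω)
      linarith [le_max_left |X ω| |Y ω|, le_max_right |X ω| |Y ω|]
    refine (Real.rpow_le_rpow (abs_nonneg _) hm hq).trans ?_
    rw [Real.mul_rpow zero_le_two (le_max_of_le_left (abs_nonneg _))]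
    gcongr
    rcases max_choice |X ω| |Y ω| with h | h <;> rw [h] <;> linarith
  have hm : Measurable fun ω => |X ω - Y ω| ^ q :=
    (continuous_abs.measurable.comp (hX.sub hY)).pow_const q
  have hi := h5.mono' hm.aestronglyMeasurable
    (ae_of_all _ fun ω => by
      rw [Real.norm_eq_abs, abs_of_nonneg (Real.rpow_nonneg (abs_nonneg _) _)]; exact hle ω)
  refine ⟨hi, (integral_mono hi h5 hle).trans ?_⟩
  rw [integral_const_mul, integral_add h1 h3]
  gcongr

variable [IsProbabilityMeasure μ]

lemma memLp_two_of_lintegral_rpow_le {X : Ω → ℝ} (hX : Measurable X) {q : ℝ} (hq : 2 ≤ q)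
    {C : ℝ≥0} (h : ∫⁻ ω, ‖X ω‖ₑ ^ q ∂μ ≤ C) :
    MemLp X 2 μ ∧ ∫ ω, X ω ^ 2 ∂μ ≤ 1 + C := by
  obtain ⟨h1, h2⟩ := integrable_abs_rpow_of_lintegral_le hX (by linarith) h
  have h3 : Integrable (fun ω => 1 + |X ω| ^ q) μ := (integrable_const 1).add h1
  have h4 : Integrable (fun ω => X ω ^ 2) μ := h3.mono' (hX.pow_const 2).aestronglyMeasurable
    (ae_of_all _ fun ω => by
      rw [Real.norm_eq_abs, abs_of_nonneg (sq_nonneg _)]; exact sq_le_one_add_abs_rpow _ hq)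
  refine ⟨(memLp_two_iff_integrable_sq hX.aestronglyMeasurable).2 h4, ?_⟩
  calc _ ≤ ∫ ω, (1 + |X ω| ^ q) ∂μ := integral_mono h4 h3 fun ω => sq_le_one_add_abs_rpow _ hq
    _ ≤ 1 + C := by
      rw [integral_add (integrable_const 1) h1]
      simpa using h2

end Moments

section Truncation

/-- The positive part of `x`, truncated at `M`. -/
noncomputable def truncPos (M x : ℝ) : ℝ := min (max x 0) M

lemma truncPos_nonneg {M : ℝ} (hM : 0 ≤ M) (x : ℝ) : 0 ≤ truncPos M x :=
  le_min (le_max_right _ _) hM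

lemma truncPos_le (M x : ℝ) : truncPos M x ≤ M := min_le_right _ _

lemma measurable_truncPos (M : ℝ) : Measurable (truncPos M) := by
  unfold truncPos
  fun_prop

lemma sq_truncPos_add_le {M δ : ℝ} (hM : 0 ≤ M) (hδ : 0 ≤ δ) (x : ℝ) :
    truncPos M (x + δ) ^ 2 ≤ truncPos M x ^ 2 + 2 * M * δ := by
  have h0 := truncPos_nonneg hM x
  have h0' := truncPos_nonneg hM (x + δ)
  have h1 := truncPos_le M x
  have h1' := truncPos_le M (x + δ)
  have h2 : truncPos M (x + δ) ≤ truncPos M x + δ := by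
    unfold truncPos
    rw [← min_add_add_right, ← max_add_add_right]
    exact min_le_min (max_le_max le_rfl (by linarith)) (by linarith)
  have h3 : (truncPos M (x + δ) + truncPos M x) * (truncPos M (x + δ) - truncPos M x) ≤
      (truncPos M (x + δ) + truncPos M x) * δ :=
    mul_le_mul_of_nonneg_left (by linarith) (by linarith)
  have h4 : (truncPos M (x + δ) + truncPos M x) * δ ≤ (2 * M) * δ :=
    mul_le_mul_of_nonneg_right (by linarith) hδ
  nlinarith

lemma lt_sq_truncPos_iff {M s : ℝ} (hM : 0 ≤ M) (hs : 0 ≤ s) (x : ℝ) :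
    s < truncPos M x ^ 2 ↔ √s < x ∧ s < M ^ 2 := by
  rw [← Real.sqrt_lt_sqrt_iff hs, Real.sqrt_sq (truncPos_nonneg hM x), truncPos, lt_min_iff,
    lt_max_iff, or_iff_left (not_lt.2 (Real.sqrt_nonneg s)), ← Real.sqrt_lt_sqrt_iff hs,
    Real.sqrt_sq hM]

lemma sq_truncPos_add_sq_truncPos_neg {M : ℝ} (hM : 0 ≤ M) (x : ℝ) :
    truncPos M x ^ 2 + truncPos M (-x) ^ 2 = min |x| M ^ 2 := by
  unfold truncPos
  rcases le_total 0 x with h | h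
  · rw [max_eq_left h, max_eq_right (neg_nonpos.2 h), min_eq_left hM, abs_of_nonneg h]
    ring
  · rw [max_eq_right h, max_eq_left (neg_nonneg.2 h), min_eq_left hM, abs_of_nonpos h]
    ring

lemma sq_truncPos_add_sq_truncPos_neg_le {M : ℝ} (hM : 0 ≤ M) (x : ℝ) :
    truncPos M x ^ 2 + truncPos M (-x) ^ 2 ≤ x ^ 2 := by
  rw [sq_truncPos_add_sq_truncPos_neg hM, ← sq_abs x]
  exact pow_le_pow_left₀ (le_min (abs_nonneg _) hM) (min_le_left _ _) 2

/-- The truncation error of the square is controlled by a moment of higher order. -/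
lemma sq_le_sq_truncPos_add {M ξ : ℝ} (hM : 0 < M) (hξ : 0 < ξ) (x : ℝ) :
    x ^ 2 ≤ truncPos M x ^ 2 + truncPos M (-x) ^ 2 + |x| ^ (2 + ξ) / M ^ ξ := by
  rw [sq_truncPos_add_sq_truncPos_neg hM.le]
  have hMξ : 0 < M ^ ξ := Real.rpow_pos_of_pos hM _
  rcases le_total |x| M with h | h
  · rw [min_eq_left h, sq_abs]
    have := Real.rpow_nonneg (abs_nonneg x) (2 + ξ)
    have : 0 ≤ |x| ^ (2 + ξ) / M ^ ξ := by positivity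
    linarith
  · have h1 : x ^ 2 ≤ |x| ^ (2 + ξ) / M ^ ξ := by
      rw [le_div_iff₀ hMξ, Real.rpow_add (hM.trans_le h), Real.rpow_two, sq_abs]
      exact mul_le_mul_of_nonneg_left (Real.rpow_le_rpow hM.le h hξ.le) (sq_nonneg _)
    have := sq_nonneg (min |x| M)
    linarith

variable {Ω : Type*} [MeasurableSpace Ω] {μ : Measure Ω} [IsProbabilityMeasure μ]

lemma integrable_sq_truncPos {X : Ω → ℝ} (hX : Measurable X) {M : ℝ} (hM : 0 ≤ M) :
    Integrable (fun ω => truncPos M (X ω) ^ 2) μ :=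
  Integrable.of_bound (((measurable_truncPos M).comp hX).pow_const 2).aestronglyMeasurable (M ^ 2)
    (ae_of_all _ fun ω => by
      rw [Real.norm_eq_abs, abs_of_nonneg (sq_nonneg _)]
      exact pow_le_pow_left₀ (truncPos_nonneg hM _) (truncPos_le _ _) 2)

/-- Layer cake comparison of truncated second moments under an approximate stochastic order. -/
lemma integral_sq_truncPos_le {X Y : Ω → ℝ} (hX : Measurable X) (hY : Measurable Y)
    {M δ ε : ℝ} (hM : 0 ≤ M) (hδ : 0 ≤ δ) (hε : 0 ≤ ε)
    (h : ∀ s, μ.real {ω | s < Y ω} ≤ μ.real {ω | s < X ω + δ} + ε) :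
    ∫ ω, truncPos M (Y ω) ^ 2 ∂μ ≤
      ∫ ω, truncPos M (X ω) ^ 2 ∂μ + (2 * M * δ + ε * M ^ 2) := by
  have hXδ : Measurable fun ω => X ω + δ := hX.add_const δ
  have hiY := integrable_sq_truncPos (μ := μ) hY hM
  have hiX := integrable_sq_truncPos (μ := μ) hX hM
  have hiXδ := integrable_sq_truncPos (μ := μ) hXδ hM
  have h0 : ∀ W : Ω → ℝ, 0 ≤ᵐ[μ] fun ω => truncPos M (W ω) ^ 2 := fun W =>
    ae_of_all _ fun ω => sq_nonneg _
  have hcake : ∫⁻ ω, ENNReal.ofReal (truncPos M (Y ω) ^ 2) ∂μ ≤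
      ∫⁻ ω, ENNReal.ofReal (truncPos M (X ω + δ) ^ 2) ∂μ + ENNReal.ofReal (ε * M ^ 2) := by
    rw [lintegral_eq_lintegral_meas_lt μ (h0 Y) hiY.aemeasurable,
      lintegral_eq_lintegral_meas_lt μ (h0 fun ω => X ω + δ) hiXδ.aemeasurable]
    have hind : ∫⁻ s in Set.Ioi (0 : ℝ),
        (Set.Iio (M ^ 2)).indicator (fun _ => ENNReal.ofReal ε) s = ENNReal.ofReal (ε * M ^ 2) := by
      rw [lintegral_indicator measurableSet_Iio, lintegral_const,
        Measure.restrict_apply MeasurableSet.univ, Set.univ_inter,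
        Measure.restrict_apply measurableSet_Iio, Set.Iio_inter_Ioi, Real.volume_Ioo, sub_zero,
        ← ENNReal.ofReal_mul hε]
    rw [← hind, ← lintegral_add_right _ (measurable_const.indicator measurableSet_Iio)]
    refine setLIntegral_mono' measurableSet_Ioi fun s hs => ?_
    simp only [lt_sq_truncPos_iff hM (le_of_lt hs)]
    by_cases hsM : s < M ^ 2
    · rw [Set.indicator_of_mem (show s ∈ Set.Iio (M ^ 2) from hsM)]
      simp only [hsM, and_true]
      have := ENNReal.ofReal_le_ofReal (h √s)
      rwa [ENNReal.ofReal_add measureReal_nonneg hε, ofReal_measureReal, ofReal_measureReal] at this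
    · simp [hsM]
  have hreal : ∫ ω, truncPos M (Y ω) ^ 2 ∂μ ≤
      ∫ ω, truncPos M (X ω + δ) ^ 2 ∂μ + ε * M ^ 2 := by
    rw [← ofReal_integral_eq_lintegral_ofReal hiY (h0 Y),
      ← ofReal_integral_eq_lintegral_ofReal hiXδ (h0 fun ω => X ω + δ),
      ← ENNReal.ofReal_add (integral_nonneg fun ω => sq_nonneg _) (by positivity)] at hcake
    exact (ENNReal.ofReal_le_ofReal_iff (add_nonneg (integral_nonneg fun ω => sq_nonneg _)
      (by positivity))).1 hcake
  have hshift : ∫ ω, truncPos M (X ω + δ) ^ 2 ∂μ ≤ ∫ ω, truncPos M (X ω) ^ 2 ∂μ + 2 * M * δ := by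
    calc _ ≤ ∫ ω, (truncPos M (X ω) ^ 2 + 2 * M * δ) ∂μ :=
          integral_mono hiXδ (hiX.add (integrable_const _)) fun ω => sq_truncPos_add_le hM hδ _
      _ = _ := by
          rw [integral_add hiX (integrable_const _)]
          simp
  linarith

/-- One-sided comparison of second moments for random variables whose distribution functions are
close in the Lévy sense. -/
lemma integral_sq_le_of_levy_close {X Y : Ω → ℝ} (hX : Measurable X) (hY : Measurable Y)
    (hX2 : Integrable (fun ω => X ω ^ 2) μ) (hY2 : Integrable (fun ω => Y ω ^ 2) μ)
    {M δ ε ξ K : ℝ} (hM : 0 < M) (hδ : 0 < δ) (hε : 0 ≤ ε) (hξ : 0 < ξ)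
    (hYξ : Integrable (fun ω => |Y ω| ^ (2 + ξ)) μ) (hK : ∫ ω, |Y ω| ^ (2 + ξ) ∂μ ≤ K)
    (h1 : ∀ t, μ.real {ω | X ω ≤ t} ≤ μ.real {ω | Y ω ≤ t + δ} + ε)
    (h2 : ∀ t, μ.real {ω | Y ω ≤ t} ≤ μ.real {ω | X ω ≤ t + δ} + ε) :
    ∫ ω, Y ω ^ 2 ∂μ ≤ ∫ ω, X ω ^ 2 ∂μ + 2 * (2 * M * (2 * δ) + ε * M ^ 2) + K / M ^ ξ := by
  have hcompl : ∀ (W : Ω → ℝ) (_ : Measurable W) (s : ℝ),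
      μ.real {ω | s < W ω} = 1 - μ.real {ω | W ω ≤ s} := fun W hW s => by
    rw [← probReal_compl_eq_one_sub (measurableSet_le hW measurable_const)]
    congr 1
    ext ω
    simp
  have hpos := integral_sq_truncPos_le (μ := μ) hX hY hM.le (by linarith : 0 ≤ 2 * δ) hε fun s => by
    have e : {ω | s < X ω + 2 * δ} = {ω | s - 2 * δ < X ω} := by
      ext ω
      simp only [Set.mem_ofPred_eq]
      constructor <;> intro h <;> linarith
    have m : μ.real {ω | X ω ≤ s - 2 * δ} ≤ μ.real {ω | X ω ≤ s - δ} :=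
      measureReal_mono fun ω (hω : X ω ≤ s - 2 * δ) => show X ω ≤ s - δ by linarith
    have := h1 (s - δ)
    rw [sub_add_cancel] at this
    rw [e, hcompl Y hY, hcompl X hX]
    linarith
  -- closed and open half-lines are interchanged at the expense of a second shift by `δ`
  have hneg := integral_sq_truncPos_le (μ := μ) hX.neg hY.neg hM.le
      (by linarith : 0 ≤ 2 * δ) hε fun s => by
    have e1 : μ.real {ω | s < (-Y) ω} ≤ μ.real {ω | Y ω ≤ -s} := by
      refine measureReal_mono fun ω (hω : s < -Y ω) => ?_
      show Y ω ≤ -s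
      linarith
    have e2 : μ.real {ω | X ω ≤ -s + δ} ≤ μ.real {ω | s < (-X) ω + 2 * δ} := by
      refine measureReal_mono fun ω (hω : X ω ≤ -s + δ) => ?_
      show s < -X ω + 2 * δ
      linarith
    linarith [h2 (-s)]
  have iYp := integrable_sq_truncPos (μ := μ) hY hM.le
  have iYn := integrable_sq_truncPos (μ := μ) hY.neg hM.le
  have iXp := integrable_sq_truncPos (μ := μ) hX hM.le
  have iXn := integrable_sq_truncPos (μ := μ) hX.neg hM.le
  have iY : Integrable (fun ω => truncPos M (Y ω) ^ 2 + truncPos M ((-Y) ω) ^ 2) μ := iYp.add iYn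
  have hMξ : 0 < M ^ ξ := Real.rpow_pos_of_pos hM _
  have hYle : ∫ ω, Y ω ^ 2 ∂μ ≤ ∫ ω, truncPos M (Y ω) ^ 2 ∂μ + ∫ ω, truncPos M ((-Y) ω) ^ 2 ∂μ
      + K / M ^ ξ := by
    calc _ ≤ ∫ ω, (truncPos M (Y ω) ^ 2 + truncPos M ((-Y) ω) ^ 2
          + |Y ω| ^ (2 + ξ) / M ^ ξ) ∂μ :=
          integral_mono hY2 (iY.add (hYξ.div_const _)) fun ω => sq_le_sq_truncPos_add hM hξ _
      _ = ∫ ω, truncPos M (Y ω) ^ 2 ∂μ + ∫ ω, truncPos M ((-Y) ω) ^ 2 ∂μ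
          + (∫ ω, |Y ω| ^ (2 + ξ) ∂μ) / M ^ ξ := by
          rw [integral_add iY (hYξ.div_const _), integral_add iYp iYn, integral_div]
      _ ≤ _ := by gcongr
  have hXge : ∫ ω, truncPos M (X ω) ^ 2 ∂μ + ∫ ω, truncPos M ((-X) ω) ^ 2 ∂μ ≤ ∫ ω, X ω ^ 2 ∂μ := by
    rw [← integral_add iXp iXn]
    exact integral_mono (iXp.add iXn) hX2 fun ω => sq_truncPos_add_sq_truncPos_neg_le hM.le _
  linarith

end Truncation

/-! ### Mean squared update and variances -/

section SecondMoments

lemma abs_integral_mul_le {Ω : Type*} [MeasurableSpace Ω] {μ : Measure Ω} {f g : Ω → ℝ}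
    (hf : MemLp f 2 μ) (hg : MemLp g 2 μ) {B : ℝ}
    (hB : ∫ ω, f ω ^ 2 ∂μ ≤ B) :
    |∫ ω, f ω * g ω ∂μ| ≤ √B * √(∫ ω, g ω ^ 2 ∂μ) := by
  have h0 : 0 ≤ ∫ ω, g ω ^ 2 ∂μ := integral_nonneg fun ω => sq_nonneg _
  have hB0 : 0 ≤ B := (integral_nonneg fun ω => sq_nonneg _).trans hB
  rw [← Real.sqrt_mul hB0]
  exact Real.abs_le_sqrt ((sq_integral_mul_le hf hg).trans (mul_le_mul_of_nonneg_right hB h0))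

variable {Ω : Type*} [MeasurableSpace Ω] {μ : Measure Ω} [IsProbabilityMeasure μ] {p n : ℕ}
  {P : Measure (Obs p)} [IsProbabilityMeasure P] {Z : Fin (n + 1 + 1) → Ω → Obs p}
  {A : PredictionAlgorithm}

lemma abs_integral_le_sqrt {f : Ω → ℝ} (hf : MemLp f 2 μ) :
    |∫ ω, f ω ∂μ| ≤ √(∫ ω, f ω ^ 2 ∂μ) := by
  have := abs_integral_mul_le (μ := μ) (memLp_const (1 : ℝ)) hf (B := 1) (by simp)
  simpa using this

/-- Orthogonality of the update and the reduced predictor, up to the drift, turns the difference of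
the variances into the mean squared update. -/
lemma abs_variance_sub_sub_integral_sq_le (hA : A.IsMeasurable) (hZ : IsIIDSample Z P μ)
    (ha : MemLp (predictor A Z) 2 μ) (hb : MemLp (predictorLoo A Z) 2 μ) {B : ℝ}
    (haB : ∫ ω, predictor A Z ω ^ 2 ∂μ ≤ B) (hbB : ∫ ω, predictorLoo A Z ω ^ 2 ∂μ ≤ B) :
    |variance (predictor A Z) μ - variance (predictorLoo A Z) μ
        - ∫ ω, (predictor A Z ω - predictorLoo A Z ω) ^ 2 ∂μ| ≤
      4 * √B * √(∫ ω, updateDrift A Z μ ω ^ 2 ∂μ) := by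
  set a := predictor A Z
  set b := predictorLoo A Z
  set d := updateDrift A Z μ
  have hd : MemLp d 2 μ := memLp_updateDrift ha hb
  have i1 : ∫ ω, a ω ∂μ - ∫ ω, b ω ∂μ = ∫ ω, d ω ∂μ := by
    rw [← integral_sub (ha.integrable one_le_two) (hb.integrable one_le_two)]
    simpa using integral_mul_update_eq_integral_mul_updateDrift hA hZ ha hb
      (g := fun _ => 1) measurable_const (memLp_const 1)
  have hgb : Measurable fun q : (Fin n → Obs p) × Obs p => A p n q.2.2 q.1 :=
    (hA p n).comp (by fun_prop : Measurable fun q : (Fin n → Obs p) × Obs p => (q.2.2, q.1))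
  have i2 : ∫ ω, b ω * (a ω - b ω) ∂μ = ∫ ω, b ω * d ω ∂μ :=
    integral_mul_update_eq_integral_mul_updateDrift hA hZ ha hb hgb hb
  have hbab : Integrable (fun ω => b ω * (a ω - b ω)) μ := hb.integrable_mul (ha.sub hb)
  have i3 : ∫ ω, (a ω - b ω) ^ 2 ∂μ =
      ∫ ω, a ω ^ 2 ∂μ - ∫ ω, b ω ^ 2 ∂μ - 2 * ∫ ω, b ω * (a ω - b ω) ∂μ := by
    have e : (fun ω => (a ω - b ω) ^ 2) =
        fun ω => a ω ^ 2 - b ω ^ 2 - 2 * (b ω * (a ω - b ω)) := by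
      ext ω
      ring
    have hab : Integrable (fun ω => a ω ^ 2 - b ω ^ 2) μ := ha.integrable_sq.sub hb.integrable_sq
    rw [e, integral_sub hab (hbab.const_mul 2), integral_sub ha.integrable_sq hb.integrable_sq,
      integral_const_mul]
  have c1 := abs_integral_mul_le hb hd hbB
  have c2 := abs_integral_le_sqrt hd
  have c3 := (abs_integral_le_sqrt ha).trans (Real.sqrt_le_sqrt haB)
  have c4 := (abs_integral_le_sqrt hb).trans (Real.sqrt_le_sqrt hbB)
  have hs : 0 ≤ √(∫ ω, d ω ^ 2 ∂μ) := Real.sqrt_nonneg _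
  rw [variance_eq_sub ha, variance_eq_sub hb]
  simp only [Pi.pow_apply]
  rw [i3, i2]
  have e : ∫ ω, a ω ^ 2 ∂μ - (∫ ω, a ω ∂μ) ^ 2 - (∫ ω, b ω ^ 2 ∂μ - (∫ ω, b ω ∂μ) ^ 2)
      - (∫ ω, a ω ^ 2 ∂μ - ∫ ω, b ω ^ 2 ∂μ - 2 * ∫ ω, b ω * d ω ∂μ) =
      2 * ∫ ω, b ω * d ω ∂μ - (∫ ω, a ω ∂μ + ∫ ω, b ω ∂μ) * ∫ ω, d ω ∂μ := by
    rw [← i1]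
    ring
  rw [e]
  refine (abs_sub _ _).trans ?_
  rw [abs_mul, abs_mul, abs_two]
  have c5 : |∫ ω, a ω ∂μ + ∫ ω, b ω ∂μ| * |∫ ω, d ω ∂μ| ≤ (√B + √B) * √(∫ ω, d ω ^ 2 ∂μ) :=
    mul_le_mul ((abs_add_le _ _).trans (add_le_add c3 c4)) c2 (abs_nonneg _) (by positivity)
  linarith

/-- The difference of the second moments of the full-sample and the leave-one-out prediction errors
is the mean squared update, up to the drift. -/
lemma abs_integral_sq_error_sub_sub_integral_sq_le (hA : A.IsMeasurable)
    (hZ : IsIIDSample Z P μ)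
    (ha : MemLp (predictor A Z) 2 μ) (hb : MemLp (predictorLoo A Z) 2 μ)
    (hy : MemLp (fun ω => (newPair Z ω).1) 2 μ) {B : ℝ}
    (hyB : ∫ ω, (newPair Z ω).1 ^ 2 ∂μ ≤ B) (hbB : ∫ ω, predictorLoo A Z ω ^ 2 ∂μ ≤ B) :
    |∫ ω, ((newPair Z ω).1 - predictor A Z ω) ^ 2 ∂μ
        - ∫ ω, ((newPair Z ω).1 - predictorLoo A Z ω) ^ 2 ∂μ
        - ∫ ω, (predictor A Z ω - predictorLoo A Z ω) ^ 2 ∂μ| ≤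
      4 * √B * √(∫ ω, updateDrift A Z μ ω ^ 2 ∂μ) := by
  set a := predictor A Z
  set b := predictorLoo A Z
  set d := updateDrift A Z μ
  set y := fun ω => (newPair Z ω).1 with hydef
  have hd : MemLp d 2 μ := memLp_updateDrift ha hb
  have hgb : Measurable fun q : (Fin n → Obs p) × Obs p => A p n q.2.2 q.1 :=
    (hA p n).comp (by fun_prop : Measurable fun q : (Fin n → Obs p) × Obs p => (q.2.2, q.1))
  have i2 : ∫ ω, b ω * (a ω - b ω) ∂μ = ∫ ω, b ω * d ω ∂μ :=
    integral_mul_update_eq_integral_mul_updateDrift hA hZ ha hb hgb hb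
  have i3 : ∫ ω, y ω * (a ω - b ω) ∂μ = ∫ ω, y ω * d ω ∂μ :=
    integral_mul_update_eq_integral_mul_updateDrift hA hZ ha hb
      (g := fun q => q.2.1) (by fun_prop) hy
  have hya : Integrable (fun ω => (y ω - a ω) ^ 2) μ := (hy.sub ha).integrable_sq
  have hyb : Integrable (fun ω => (y ω - b ω) ^ 2) μ := (hy.sub hb).integrable_sq
  have hab : Integrable (fun ω => (a ω - b ω) ^ 2) μ := (ha.sub hb).integrable_sq
  have hb2 : Integrable (fun ω => 2 * (b ω * (a ω - b ω))) μ :=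
    (hb.integrable_mul (ha.sub hb)).const_mul 2
  have hy2 : Integrable (fun ω => 2 * (y ω * (a ω - b ω))) μ :=
    (hy.integrable_mul (ha.sub hb)).const_mul 2
  have e : ∫ ω, (y ω - a ω) ^ 2 ∂μ - ∫ ω, (y ω - b ω) ^ 2 ∂μ - ∫ ω, (a ω - b ω) ^ 2 ∂μ =
      2 * ∫ ω, b ω * d ω ∂μ - 2 * ∫ ω, y ω * d ω ∂μ := by
    have hd1 : Integrable (fun ω => (y ω - a ω) ^ 2 - (y ω - b ω) ^ 2) μ := hya.sub hyb
    rw [← i2, ← i3, ← integral_const_mul, ← integral_const_mul, ← integral_sub hya hyb,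
      ← integral_sub hd1 hab, ← integral_sub hb2 hy2]
    congr 1
    ext ω
    ring
  rw [e]
  have c1 := abs_integral_mul_le hb hd hbB
  have c2 := abs_integral_mul_le hy hd hyB
  refine (abs_sub _ _).trans ?_
  rw [abs_mul, abs_mul, abs_two]
  linarith

end SecondMoments

/-! ### Smoothed indicators and stability -/

section SmoothIndicator

/-- The piecewise linear function that is `1` on `(-∞, t]` and `0` on `[t + h, ∞)`. -/
noncomputable def smoothIndicator (t h u : ℝ) : ℝ := max (min (1 - (u - t) / h) 1) 0

lemma smoothIndicator_mem_Icc (t h u : ℝ) : smoothIndicator t h u ∈ Set.Icc (0 : ℝ) 1 :=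
  ⟨le_max_right _ _, max_le (min_le_right _ _) zero_le_one⟩

lemma measurable_smoothIndicator (t h : ℝ) : Measurable (smoothIndicator t h) := by
  unfold smoothIndicator
  fun_prop

lemma abs_smoothIndicator_sub_le {h : ℝ} (hh : 0 < h) (t u v : ℝ) :
    |smoothIndicator t h u - smoothIndicator t h v| ≤ 1 / h * |u - v| := by
  unfold smoothIndicator
  refine (abs_max_sub_max_le_abs _ _ _).trans ((abs_min_sub_min_le_max _ _ _ _).trans_eq ?_)
  rw [sub_self, abs_zero, max_eq_left (abs_nonneg _)]
  have : 1 - (u - t) / h - (1 - (v - t) / h) = 1 / h * -(u - v) := by ring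
  rw [this, abs_mul, abs_neg, abs_of_pos (by positivity)]

lemma smoothIndicator_eq_one {t h u : ℝ} (hh : 0 < h) (hu : u ≤ t) :
    smoothIndicator t h u = 1 := by
  unfold smoothIndicator
  have : (u - t) / h ≤ 0 := div_nonpos_of_nonpos_of_nonneg (by linarith) hh.le
  rw [min_eq_right (by linarith), max_eq_left zero_le_one]

lemma smoothIndicator_eq_zero {t h u : ℝ} (hh : 0 < h) (hu : t + h < u) :
    smoothIndicator t h u = 0 := by
  unfold smoothIndicator
  have : 1 ≤ (u - t) / h := (one_le_div hh).2 (by linarith)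
  rw [max_eq_right ((min_le_left _ _).trans (by linarith))]

end SmoothIndicator

section LevyClose

/-- Closeness of two distribution functions on a sufficiently wide and fine grid implies their
uniform Lévy closeness. -/
lemma levy_close_of_grid {F G : ℝ → ℝ} (hF : Monotone F) (hG : Monotone G)
    (hF0 : ∀ t, 0 ≤ F t) (hF1 : ∀ t, F t ≤ 1) (hG0 : ∀ t, 0 ≤ G t) (hG1 : ∀ t, G t ≤ 1)
    {t₀ h ε : ℝ} (hh : 0 < h) {J : ℕ}
    (hFG : ∀ j ≤ J, F (t₀ + j * h) ≤ G (t₀ + j * h + h) + ε)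
    (hGF : ∀ j ≤ J, G (t₀ + j * h) ≤ F (t₀ + j * h + h) + ε)
    (hlo : G (t₀ + h) ≤ ε) (hhi : 1 - ε ≤ G (t₀ + J * h)) (t : ℝ) :
    F t ≤ G (t + 2 * h) + 2 * ε ∧ G t ≤ F (t + 2 * h) + 2 * ε := by
  have hε : 0 ≤ ε := (hG0 _).trans hlo
  rcases lt_or_ge t t₀ with ht | ht
  · have h1 := hFG 0 (Nat.zero_le _)
    simp only [Nat.cast_zero, zero_mul, add_zero] at h1
    have h2 := hF ht.le
    have h3 : G t ≤ G (t₀ + h) := hG (by linarith)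
    constructor <;> linarith [hF0 (t + 2 * h), hG0 (t + 2 * h)]
  rcases lt_or_ge (t₀ + J * h) t with ht' | ht'
  · have h1 := hGF J le_rfl
    have h2 : G (t₀ + J * h) ≤ G (t + 2 * h) := hG (by linarith)
    have h3 : F (t₀ + J * h + h) ≤ F (t + 2 * h) := hF (by linarith)
    constructor <;> linarith [hF1 t, hG1 t]
  -- the next grid point above `t`
  obtain ⟨j, hj, hjt, htj⟩ : ∃ j ≤ J, t ≤ t₀ + j * h ∧ t₀ + j * h ≤ t + h := by
    have hx : 0 ≤ (t - t₀) / h := div_nonneg (by linarith) hh.le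
    refine ⟨⌈(t - t₀) / h⌉₊, Nat.ceil_le.2 ((div_le_iff₀ hh).2 (by linarith)), ?_, ?_⟩
    · have := (div_le_iff₀ hh).1 (Nat.le_ceil ((t - t₀) / h))
      linarith
    · have := mul_le_mul_of_nonneg_right (Nat.ceil_lt_add_one hx).le hh.le
      rw [add_mul, div_mul_cancel₀ _ hh.ne'] at this
      linarith
  have h1 := hFG j hj
  have h2 := hGF j hj
  have h3 := hF hjt
  have h4 := hG hjt
  have h5 : G (t₀ + j * h + h) ≤ G (t + 2 * h) := hG (by linarith)
  have h6 : F (t₀ + j * h + h) ≤ F (t + 2 * h) := hF (by linarith)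
  constructor <;> linarith

end LevyClose

section Stability

/-- The mean of a section probability is the probability of the set. -/
lemma integral_measureReal_section {Ω X Y : Type*} [MeasurableSpace Ω] {μ : Measure Ω}
    [MeasurableSpace X] [MeasurableSpace Y] {ν : Measure X} {ρ : Measure Y}
    [IsProbabilityMeasure ν] [IsProbabilityMeasure ρ]
    {f : Ω → X} {g : Ω → Y} (h : MeasurePreserving (fun ω => (f ω, g ω)) μ (ν.prod ρ))
    {S : Set (X × Y)} (hS : MeasurableSet S) :
    Measurable (fun ω => ν.real {x | (x, g ω) ∈ S}) ∧
      ∫ ω, ν.real {x | (x, g ω) ∈ S} ∂μ = μ.real {ω | (f ω, g ω) ∈ S} := by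
  have hg : MeasurePreserving g μ ρ := measurePreserving_snd.comp h
  have hm : Measurable fun y => ν {x | (x, y) ∈ S} := measurable_measure_prodMk_right hS
  refine ⟨(hm.comp hg.measurable).ennreal_toReal, ?_⟩
  simp only [measureReal_def]
  have h2 := integral_toReal (μ := μ) (hm.comp hg.measurable).aemeasurable
    (ae_of_all _ fun _ => measure_lt_top _ _)
  simp only [Function.comp_apply] at h2
  rw [h2, hg.lintegral_comp hm]
  have h1 : μ {ω | (f ω, g ω) ∈ S} = (ν.prod ρ) S := h.measure_preimage hS.nullMeasurableSet
  rw [h1, Measure.prod_apply_symm hS]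
  rfl

lemma measureReal_ge_le_div {Ω : Type*} [MeasurableSpace Ω] {μ : Measure Ω} {f : Ω → ℝ}
    (hf : Integrable f μ) (h0 : ∀ ω, 0 ≤ f ω) {c : ℝ}
    (hc : 0 < c) : μ.real {ω | c ≤ f ω} ≤ (∫ ω, f ω ∂μ) / c := by
  rw [le_div_iff₀ hc, mul_comm]
  exact mul_meas_ge_le_integral_of_nonneg (ae_of_all _ h0) hf c

variable {Ω : Type*} [MeasurableSpace Ω] {μ : Measure Ω} [IsProbabilityMeasure μ] {p n m : ℕ}
  {P : Measure (Obs p)} [IsProbabilityMeasure P] {A : PredictionAlgorithm}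

/-- The smoothed indicator of the event that the prediction error at the test pair is at
most `t`. -/
noncomputable def smoothError (A : PredictionAlgorithm) (N : ℕ) (t h : ℝ) (z : Obs p)
    (T : Fin N → Obs p) : ℝ :=
  smoothIndicator t h (z.1 - A p N z.2 T)

lemma measurable_error (hA : A.IsMeasurable) (N : ℕ) :
    Measurable fun q : Obs p × (Fin N → Obs p) => q.1.1 - A p N q.1.2 q.2 :=
  (by fun_prop : Measurable fun q : Obs p × (Fin N → Obs p) => q.1.1).sub
    ((hA p N).comp (by fun_prop : Measurable fun q : Obs p × (Fin N → Obs p) => (q.1.2, q.2)))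

lemma isUnitFunctional_smoothError (hA : A.IsMeasurable) (hs : A.IsSymmetric) (N : ℕ) (t h : ℝ) :
    IsUnitFunctional (smoothError (p := p) A N t h) where
  measurable := (measurable_smoothIndicator t h).comp (measurable_error hA N)
  mem_Icc _ _ := smoothIndicator_mem_Icc _ _ _
  symm z T σ := by simp only [smoothError, hs p N z.2 T σ]

lemma integral_updateGap_smoothError_le (hA : A.IsMeasurable) (hs : A.IsSymmetric)
    {Z : Fin (n + 1 + 1) → Ω → Obs p} (hZ : IsIIDSample Z P μ)
    (ha : MemLp (predictor A Z) 2 μ) (hb : MemLp (predictorLoo A Z) 2 μ)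
    (t : ℝ) {h : ℝ} (hh : 0 < h) :
    ∫ q, updateGap (smoothError A (n + 1) t h) (smoothError A n t h) q
        ∂(P.prod (P.prod (Measure.pi fun _ => P))) ≤
      1 / h * ∫ ω, |predictor A Z ω - predictorLoo A Z ω| ∂μ := by
  have hm := (isUnitFunctional_smoothError (p := p) hA hs (n + 1) t h).measurable_updateGap
    (isUnitFunctional_smoothError hA hs n t h)
  have hi : Integrable (fun ω => predictor A Z ω - predictorLoo A Z ω) μ :=
    (ha.sub hb).integrable one_le_two
  rw [← hZ.measurePreserving_newPair_lastPair_trainingDataLoo.integral_comp_of_measurable hm,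
    ← integral_const_mul]
  refine integral_mono_of_nonneg (ae_of_all _ fun _ => abs_nonneg _) (hi.abs.const_mul _)
    (ae_of_all _ fun ω => ?_)
  -- the last training pair may be put in front, by symmetry
  have hpred : predictor A Z ω = A p (n + 1) (newPair Z ω).2
      (Fin.cons (trainingData Z ω (Fin.last n)) (trainingDataLoo Z ω)) := by
    rw [predictor_eq_snoc, Fin.snoc_eq_cons_rotate]
    exact hs p (n + 1) _ _ (finRotate (n + 1))
  simp only [updateGap, smoothError]
  refine (abs_smoothIndicator_sub_le hh t _ _).trans_eq ?_
  rw [← hpred, abs_sub_comm (predictor A Z ω), predictorLoo]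
  congr 2
  ring

lemma jackknifeCDF_le_average {T : Fin (n + 1) → Obs p} {t h : ℝ} (hh : 0 < h) :
    jackknifeCDF A T t ≤ 1 / ((n + 1 : ℕ) : ℝ) *
      ∑ i, smoothError A n t h (T i) (i.removeNth T) := by
  unfold jackknifeCDF
  gcongr with i _
  split_ifs with hi
  · exact (smoothIndicator_eq_one hh hi).ge
  · exact (smoothIndicator_mem_Icc _ _ _).1

lemma average_le_jackknifeCDF {T : Fin (n + 1) → Obs p} {t h : ℝ} (hh : 0 < h) :
    1 / ((n + 1 : ℕ) : ℝ) * ∑ i, smoothError A n t h (T i) (i.removeNth T) ≤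
      jackknifeCDF A T (t + h) := by
  unfold jackknifeCDF
  gcongr with i _
  split_ifs with hi
  · exact (smoothIndicator_mem_Icc _ _ _).2
  · exact (smoothIndicator_eq_zero hh (not_le.1 hi)).le

lemma measurableSet_error_le (hA : A.IsMeasurable) (T : Fin (n + 1) → Obs p) (t : ℝ) :
    MeasurableSet {z : Obs p | z.1 - A p (n + 1) z.2 T ≤ t} :=
  measurableSet_le ((measurable_error hA (n + 1)).comp
    (by fun_prop : Measurable fun z : Obs p => (z, T))) measurable_const

lemma errorCDF_le_integral (hA : A.IsMeasurable) (hs : A.IsSymmetric)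
    {T : Fin (n + 1) → Obs p} {t h : ℝ} (hh : 0 < h) :
    errorCDF A P T t ≤ ∫ z, smoothError A (n + 1) t h z T ∂P := by
  rw [errorCDF, ← integral_indicator_one (measurableSet_error_le hA T t)]
  refine integral_mono_of_nonneg (ae_of_all _ fun z => Set.indicator_nonneg (by simp) z)
    (integrable_of_mem_Icc_zero_one
      ((isUnitFunctional_smoothError hA hs (n + 1) t h).measurable_left T)
      fun _ => smoothIndicator_mem_Icc _ _ _) (ae_of_all _ fun z => ?_)
  by_cases hz : z ∈ {z : Obs p | z.1 - A p (n + 1) z.2 T ≤ t}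
  · rw [Set.indicator_of_mem hz]
    exact (smoothIndicator_eq_one hh hz).ge
  · rw [Set.indicator_of_notMem hz]
    exact (smoothIndicator_mem_Icc _ _ _).1

lemma integral_le_errorCDF (hA : A.IsMeasurable) {T : Fin (n + 1) → Obs p} {t h : ℝ}
    (hh : 0 < h) :
    ∫ z, smoothError A (n + 1) t h z T ∂P ≤ errorCDF A P T (t + h) := by
  rw [errorCDF, ← integral_indicator_one (measurableSet_error_le hA T (t + h))]
  refine integral_mono_of_nonneg (ae_of_all _ fun z => (smoothIndicator_mem_Icc _ _ _).1)
    ((integrable_const (1 : ℝ)).indicator (measurableSet_error_le hA T (t + h)))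
    (ae_of_all _ fun z => ?_)
  by_cases hz : z ∈ {z : Obs p | z.1 - A p (n + 1) z.2 T ≤ t + h}
  · rw [Set.indicator_of_mem hz]
    exact (smoothIndicator_mem_Icc _ _ _).2
  · rw [Set.indicator_of_notMem hz]
    exact (smoothIndicator_eq_zero hh (not_le.1 hz)).le

/-- The averages of the smoothed leave-one-out indicators are close to the conditional means of the
smoothed error indicator, with high probability. -/
lemma measureReal_average_sub_integral_ge_le (hA : A.IsMeasurable) (hs : A.IsSymmetric)
    {Z : Fin (m + 1 + 1 + 1) → Ω → Obs p} (hZ : IsIIDSample Z P μ)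
    (ha : MemLp (predictor A Z) 2 μ) (hb : MemLp (predictorLoo A Z) 2 μ)
    (t : ℝ) {h ε : ℝ} (hh : 0 < h) (hε : 0 < ε) :
    μ.real {ω | ε ≤ |1 / ((m + 1 + 1 : ℕ) : ℝ) *
        ∑ i, smoothError A (m + 1) t h (trainingData Z ω i) (i.removeNth (trainingData Z ω))
        - ∫ z, smoothError A (m + 1 + 1) t h z (trainingData Z ω) ∂P|} ≤
      (1 / ((m + 2 : ℕ) : ℝ)
        + 10 * (1 / h * ∫ ω, |predictor A Z ω - predictorLoo A Z ω| ∂μ)) / ε ^ 2 := by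
  have hF := isUnitFunctional_smoothError (p := p) hA hs (m + 2) t h
  have hF' := isUnitFunctional_smoothError (p := p) hA hs (m + 1) t h
  have hT := hZ.measurePreserving_trainingData
  have hT' : ∀ i : Fin (m + 2), Measurable fun T : Fin (m + 2) → Obs p =>
      smoothError A (m + 1) t h (T i) (i.removeNth T) := fun i =>
    hF'.measurable.comp (measurePreserving_removeNth P i).measurable
  let D : (Fin (m + 2) → Obs p) → ℝ := fun T => 1 / ((m + 2 : ℕ) : ℝ) *
        ∑ i, smoothError A (m + 1) t h (T i) (i.removeNth T)
        - ∫ z, smoothError A (m + 2) t h z T ∂P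
  have hDm : Measurable D :=
    ((Finset.measurable_sum _ fun i _ => hT' i).const_mul _).sub
      (measurable_integral_left P hF.measurable)
  have hD1 : ∀ T, |D T| ≤ 1 := fun T => by
    refine abs_sub_le_one_of_mem_Icc ⟨?_, ?_⟩ (integral_mem_Icc_zero_one (hF.measurable_left T)
      fun _ => hF.mem_Icc _ _)
    · exact mul_nonneg (by positivity) (Finset.sum_nonneg fun i _ => (hF'.mem_Icc _ _).1)
    · exact (average_le_jackknifeCDF hh).trans (jackknifeCDF_le_one A T _)
  have hmain : ∫ T, D T ^ 2 ∂(Measure.pi fun _ => P) ≤ _ :=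
    hF.integral_sq_average_sub_integral_le P hF'
  rw [← hT.integral_comp_of_measurable (hDm.pow_const 2)] at hmain
  have hgap := integral_updateGap_smoothError_le hA hs hZ ha hb t hh
  have hi : Integrable (fun ω => D (trainingData Z ω) ^ 2) μ :=
    integrable_of_mem_Icc_zero_one ((hDm.comp hT.measurable).pow_const 2) fun ω =>
      ⟨sq_nonneg _, (sq_le_one_iff_abs_le_one _).2 (hD1 _)⟩
  have hmk := measureReal_ge_le_div hi (fun ω => sq_nonneg _) (sq_pos_of_pos hε)
  refine (measureReal_mono fun ω (hω : ε ≤ |D (trainingData Z ω)|) => ?_).trans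
    (hmk.trans (div_le_div_of_nonneg_right (hmain.trans (by gcongr)) (sq_nonneg _)))
  show ε ^ 2 ≤ D (trainingData Z ω) ^ 2
  rw [← sq_abs (D _)]
  exact pow_le_pow_left₀ hε.le hω 2

end Stability

/-! ### Conservativeness -/

section Conservativeness

variable {Ω : Type*} [MeasurableSpace Ω] {μ : Measure Ω} [IsProbabilityMeasure μ] {p n m : ℕ}
  {P : Measure (Obs p)} [IsProbabilityMeasure P] {A : PredictionAlgorithm}

/-- The conditional coverage is computed with the law of the new pair, which is independent of the
training data. -/
lemma ae_condCoverage_eq {Z : Fin (n + 1 + 1) → Ω → Obs p} (hZ : IsIIDSample Z P μ) :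
    ∀ᵐ ω ∂μ, ∀ α₁ α₂ δ, condCoverage A Z μ α₁ α₂ δ ω =
      P.real {z : Obs p | z.1 ∈ jackknifePI A α₁ α₂ δ z.2 (trainingData Z ω)} := by
  have h : MeasurePreserving (fun ω => (trainingData Z ω, newPair Z ω)) μ
      ((Measure.pi fun _ => P).prod P) :=
    Measure.measurePreserving_swap.comp hZ.measurePreserving_newPair_trainingData
  filter_upwards [condDistrib_ae_eq_const h] with ω hω α₁ α₂ δ
  rw [condCoverage, hω]

lemma neg_le_worstCoverageGap_iff {Z : Fin (n + 1 + 1) → Ω → Obs p} {δ ε : ℝ} {ω : Ω} :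
    -ε ≤ worstCoverageGap A Z μ δ ω ↔ ∀ α₁ α₂, 0 ≤ α₁ → α₁ ≤ α₂ → α₂ ≤ 1 →
      -ε ≤ condCoverage A Z μ α₁ α₂ δ ω - (α₂ - α₁) := by
  have hbdd : BddBelow (Set.range fun a : {a : ℝ × ℝ // 0 ≤ a.1 ∧ a.1 ≤ a.2 ∧ a.2 ≤ 1} =>
      condCoverage A Z μ a.1.1 a.1.2 δ ω - (a.1.2 - a.1.1)) := by
    refine ⟨-1, ?_⟩
    rintro _ ⟨⟨⟨a, b⟩, h1, h2, h3⟩, rfl⟩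
    have : 0 ≤ condCoverage A Z μ a b δ ω := measureReal_nonneg
    simp only at h1 h2 h3 ⊢
    linarith
  have : Nonempty {a : ℝ × ℝ // 0 ≤ a.1 ∧ a.1 ≤ a.2 ∧ a.2 ≤ 1} :=
    ⟨⟨(0, 0), le_rfl, le_rfl, zero_le_one⟩⟩
  rw [worstCoverageGap, le_ciInf_iff hbdd]
  exact ⟨fun h α₁ α₂ h1 h2 h3 => h ⟨(α₁, α₂), h1, h2, h3⟩, fun h a => h _ _ a.2.1 a.2.2.1 a.2.2.2⟩

/-- Quantitative sufficiency of stability: the worst coverage gap is small outside an event whose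
probability is controlled by the mean absolute update and the tail of the prediction error. -/
lemma exists_coverage_exceptional_set (hA : A.IsMeasurable) (hs : A.IsSymmetric)
    {Z : Fin (m + 1 + 1 + 1) → Ω → Obs p} (hZ : IsIIDSample Z P μ)
    (ha : MemLp (predictor A Z) 2 μ) (hb : MemLp (predictorLoo A Z) 2 μ)
    (hy : MemLp (fun ω => (newPair Z ω).1) 2 μ)
    {h ε M : ℝ} (hh : 0 < h) (hε : 0 < ε) (hM : 0 < M) {J : ℕ} (hJ : 2 * M + h ≤ J * h) :
    ∃ B : Set Ω, μ.real B ≤ (J + 1 : ℕ) * ((1 / ((m + 2 : ℕ) : ℝ)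
        + 10 * (1 / h * ∫ ω, |predictor A Z ω - predictorLoo A Z ω| ∂μ)) / ε ^ 2)
        + (∫ ω, ((newPair Z ω).1 - predictor A Z ω) ^ 2 ∂μ) / M ^ 2 / ε ∧
      ∀ᵐ ω ∂μ, ω ∉ B → -(4 * ε) ≤ worstCoverageGap A Z μ (4 * h) ω := by
  -- the grid `t₀ + j * h`, `j ≤ J`, reaches from `-M - h` to at least `M`
  set t₀ := -M - h with ht₀
  let D : ℕ → Ω → ℝ := fun j ω => 1 / ((m + 1 + 1 : ℕ) : ℝ) *
        ∑ i, smoothError A (m + 1) (t₀ + j * h) h (trainingData Z ω i)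
          (i.removeNth (trainingData Z ω))
        - ∫ z, smoothError A (m + 1 + 1) (t₀ + j * h) h z (trainingData Z ω) ∂P
  let S : Set (Obs p × (Fin (m + 1 + 1) → Obs p)) := {q | M ≤ |q.1.1 - A p (m + 1 + 1) q.1.2 q.2|}
  have hS : MeasurableSet S := measurableSet_le measurable_const
    (continuous_abs.measurable.comp (measurable_error hA _))
  obtain ⟨htm, hti⟩ := integral_measureReal_section hZ.measurePreserving_newPair_trainingData hS
  let τ : Ω → ℝ := fun ω => P.real {z | (z, trainingData Z ω) ∈ S}
  refine ⟨(⋃ j ∈ Finset.range (J + 1), {ω | ε ≤ |D j ω|}) ∪ {ω | ε ≤ τ ω}, ?_, ?_⟩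
  · refine (measureReal_union_le _ _).trans (add_le_add ?_ ?_)
    · refine (measureReal_biUnion_finset_le _ _).trans ?_
      calc _ ≤ ∑ _j ∈ Finset.range (J + 1), _ := Finset.sum_le_sum fun j _ =>
            measureReal_average_sub_integral_ge_le hA hs hZ ha hb (t₀ + j * h) hh hε
        _ = _ := by rw [Finset.sum_const, Finset.card_range, nsmul_eq_mul]
    · have h1 := measureReal_ge_le_div (μ := μ) (f := τ)
        (integrable_of_mem_Icc_zero_one htm fun _ => ⟨measureReal_nonneg, measureReal_le_one⟩)
        (fun _ => measureReal_nonneg) hε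
      have h2 := measureReal_ge_le_div (μ := μ) (hy.sub ha).integrable_sq
        (fun _ => sq_nonneg _) (sq_pos_of_pos hM)
      refine h1.trans (div_le_div_of_nonneg_right ?_ hε.le)
      refine hti.trans_le (le_trans (measureReal_mono fun ω hω => ?_) h2)
      show M ^ 2 ≤ ((newPair Z ω).1 - predictor A Z ω) ^ 2
      rw [← sq_abs (_ - _)]
      exact pow_le_pow_left₀ hM.le hω 2
  · filter_upwards [ae_condCoverage_eq (A := A) hZ] with ω hω hB
    simp only [Set.mem_union, Set.mem_iUnion, Set.mem_ofPred_eq, not_or, not_exists, not_le,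
      Finset.mem_range] at hB
    obtain ⟨hD, hτ⟩ := hB
    set T := trainingData Z ω
    have hgrid := levy_close_of_grid (jackknifeCDF_mono A T) (errorCDF_mono P T)
      (jackknifeCDF_nonneg A T) (jackknifeCDF_le_one A T) (fun _ => measureReal_nonneg)
      (fun _ => measureReal_le_one) hh (J := J) (t₀ := t₀) (ε := ε)
      (fun j hj => by
        have h1 := (abs_lt.1 (hD j (Nat.lt_succ_of_le hj))).2
        have h2 := jackknifeCDF_le_average (A := A) (T := T) (t := t₀ + j * h) hh
        have h3 := integral_le_errorCDF (P := P) hA (T := T) (t := t₀ + j * h) hh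
        simp only [D] at h1
        linarith)
      (fun j hj => by
        have h1 := (abs_lt.1 (hD j (Nat.lt_succ_of_le hj))).1
        have h2 := average_le_jackknifeCDF (A := A) (T := T) (t := t₀ + j * h) hh
        have h3 := errorCDF_le_integral (P := P) hA hs (T := T) (t := t₀ + j * h) hh
        simp only [D] at h1
        linarith)
      (by
        refine le_trans (measureReal_mono fun z hz => ?_) hτ.le
        have hz' : z.1 - A p (m + 1 + 1) z.2 T ≤ t₀ + h := hz
        show M ≤ |z.1 - A p (m + 1 + 1) z.2 T|
        exact le_trans (by linarith) (neg_le_abs _))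
      (by
        have h1 := probReal_compl_eq_one_sub (μ := P) (measurableSet_error_le hA T (t₀ + J * h))
        have h2 : P.real {z : Obs p | z.1 - A p (m + 1 + 1) z.2 T ≤ t₀ + J * h}ᶜ ≤ τ ω := by
          refine measureReal_mono fun z hz => ?_
          have hz' : t₀ + J * h < z.1 - A p (m + 1 + 1) z.2 T := not_le.1 hz
          show M ≤ |z.1 - A p (m + 1 + 1) z.2 T|
          exact le_trans (by linarith) (le_abs_self _)
        rw [errorCDF]
        linarith)
    refine neg_le_worstCoverageGap_iff.2 fun α₁ α₂ h1 h2 h3 => ?_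
    rw [hω]
    have e : 4 * h / 2 = 2 * h := by ring
    have := coverage_ge_of_levy_close P (T := T) (δ := 4 * h) (ε := 2 * ε) (by positivity)
      (fun t => by rw [e]; exact (hgrid t).1) (fun t => by rw [e]; exact (hgrid t).2)
      (by positivity) h1 h2 h3
    linarith

/-- The mean of the empirical distribution function of the residuals is the distribution function of
the leave-one-out prediction error at the new pair. -/
lemma integral_jackknifeCDF (hA : A.IsMeasurable) {Z : Fin (n + 1 + 1) → Ω → Obs p}
    (hZ : IsIIDSample Z P μ) (t : ℝ) :
    Measurable (fun ω => jackknifeCDF A (trainingData Z ω) t) ∧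
    ∫ ω, jackknifeCDF A (trainingData Z ω) t ∂μ =
      μ.real {ω | (newPair Z ω).1 - predictorLoo A Z ω ≤ t} := by
  have hT := hZ.measurePreserving_trainingData
  let S : Set (Obs p × (Fin n → Obs p)) := {q | q.1.1 - A p n q.1.2 q.2 ≤ t}
  have hS : MeasurableSet S := measurableSet_le (measurable_error hA n) measurable_const
  have hlaw : μ.real {ω | (newPair Z ω).1 - predictorLoo A Z ω ≤ t} =
      (P.prod (Measure.pi fun _ => P)).real S := by
    rw [measureReal_def, measureReal_def,
      ← hZ.measurePreserving_newPair_trainingDataLoo.measure_preimage hS.nullMeasurableSet]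
    rfl
  have hres : ∀ i : Fin (n + 1), MeasurePreserving
      (fun ω => (trainingData Z ω i, i.removeNth (trainingData Z ω))) μ
      (P.prod (Measure.pi fun _ => P)) := fun i => (measurePreserving_removeNth P i).comp hT
  let I : Fin (n + 1) → Ω → ℝ := fun i =>
    ((fun ω => (trainingData Z ω i, i.removeNth (trainingData Z ω))) ⁻¹' S).indicator 1
  have hSi : ∀ i, MeasurableSet
      ((fun ω => (trainingData Z ω i, i.removeNth (trainingData Z ω))) ⁻¹' S) := fun i =>
    (hres i).measurable hS
  have hIm : ∀ i, Measurable (I i) := fun i => measurable_one.indicator (hSi i)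
  have heq : (fun ω => jackknifeCDF A (trainingData Z ω) t) =
      fun ω => 1 / ((n + 1 : ℕ) : ℝ) * ∑ i, I i ω := by
    ext ω
    unfold jackknifeCDF
    congr 1
  have hIi : ∀ i, ∫ ω, I i ω ∂μ = (P.prod (Measure.pi fun _ => P)).real S := fun i => by
    rw [integral_indicator_one (hSi i), measureReal_def,
      (hres i).measure_preimage hS.nullMeasurableSet, measureReal_def]
  have hint : ∀ i, Integrable (I i) μ := fun i => (integrable_const 1).indicator (hSi i)
  rw [heq]
  refine ⟨(Finset.measurable_sum _ fun i _ => hIm i).const_mul _, ?_⟩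
  rw [integral_const_mul, integral_finsetSum _ fun i _ => hint i, hlaw]
  simp only [hIi, Finset.sum_const, Finset.card_univ, Fintype.card_fin, nsmul_eq_mul]
  field_simp

lemma integral_errorCDF (hA : A.IsMeasurable) {Z : Fin (n + 1 + 1) → Ω → Obs p}
    (hZ : IsIIDSample Z P μ) (t : ℝ) :
    Measurable (fun ω => errorCDF A P (trainingData Z ω) t) ∧
    ∫ ω, errorCDF A P (trainingData Z ω) t ∂μ =
      μ.real {ω | (newPair Z ω).1 - predictor A Z ω ≤ t} :=
  integral_measureReal_section hZ.measurePreserving_newPair_trainingData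
    (S := {q | q.1.1 - A p (n + 1) q.1.2 q.2 ≤ t})
    (measurableSet_le (measurable_error hA (n + 1)) measurable_const)

/-- Two random functions with values in the unit interval that are comparable on an event of large
outer probability have comparable means. -/
lemma integral_le_integral_add_of_measure_ge {X Y : Ω → ℝ} (hX : Measurable X) (hY : Measurable Y)
    (hX1 : ∀ ω, X ω ∈ Set.Icc (0 : ℝ) 1) (hY1 : ∀ ω, Y ω ∈ Set.Icc (0 : ℝ) 1) {ε κ : ℝ}
    (hε : 0 ≤ ε) {S : Set Ω}
    (hS : 1 - κ ≤ μ.real S) (h : ∀ᵐ ω ∂μ, ω ∈ S → X ω ≤ Y ω + ε) :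
    ∫ ω, X ω ∂μ ≤ ∫ ω, Y ω ∂μ + ε + κ := by
  let V : Set Ω := {ω | X ω ≤ Y ω + ε}
  have hV : MeasurableSet V := measurableSet_le hX (hY.add_const ε)
  have hSV : μ.real S ≤ μ.real V := ENNReal.toReal_mono (measure_ne_top _ _) (measure_mono_ae h)
  have hVc := probReal_compl_eq_one_sub (μ := μ) hV
  have hiX := integrable_of_mem_Icc_zero_one (ρ := μ) hX hX1
  have hiY := integrable_of_mem_Icc_zero_one (ρ := μ) hY hY1
  have hiV : Integrable (Vᶜ.indicator (1 : Ω → ℝ)) μ := (integrable_const 1).indicator hV.compl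
  have hiYε : Integrable (fun ω => Y ω + ε) μ := hiY.add (integrable_const ε)
  calc ∫ ω, X ω ∂μ ≤ ∫ ω, ((Y ω + ε) + Vᶜ.indicator (1 : Ω → ℝ) ω) ∂μ := by
        refine integral_mono hiX (hiYε.add hiV) fun ω => ?_
        by_cases hω : X ω ≤ Y ω + ε
        · have : 0 ≤ Vᶜ.indicator (1 : Ω → ℝ) ω := Set.indicator_nonneg (by simp) _
          simp only
          linarith
        · have : ω ∈ Vᶜ := hω
          simp only [Set.indicator_of_mem this, Pi.one_apply]
          linarith [(hX1 ω).2, (hY1 ω).1]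
    _ = ∫ ω, Y ω ∂μ + ε + μ.real Vᶜ := by
        rw [integral_add hiYε hiV, integral_add hiY (integrable_const ε),
          integral_indicator_one hV.compl]
        simp
    _ ≤ _ := by linarith

/-- Conditional conservativeness makes the unconditional distribution functions of the full-sample
and the leave-one-out prediction errors close in the Lévy sense. -/
lemma levy_close_of_measureReal_coverage_ge (hA : A.IsMeasurable)
    {Z : Fin (n + 1 + 1) → Ω → Obs p} (hZ : IsIIDSample Z P μ) {δ ε κ : ℝ} (hδ : 0 < δ)
    (hε : 0 < ε) (hκ : 1 - κ ≤ μ.real {ω | -ε ≤ worstCoverageGap A Z μ δ ω}) (t : ℝ) :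
    μ.real {ω | (newPair Z ω).1 - predictor A Z ω ≤ t} ≤
        μ.real {ω | (newPair Z ω).1 - predictorLoo A Z ω ≤ t + 2 * δ} + (2 * ε + κ) ∧
      μ.real {ω | (newPair Z ω).1 - predictorLoo A Z ω ≤ t} ≤
        μ.real {ω | (newPair Z ω).1 - predictor A Z ω ≤ t + 2 * δ} + (2 * ε + κ) := by
  have hcov : ∀ᵐ ω ∂μ, ω ∈ {ω | -ε ≤ worstCoverageGap A Z μ δ ω} →
      ∀ α₁ α₂, 0 ≤ α₁ → α₁ ≤ α₂ → α₂ ≤ 1 → -ε ≤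
        P.real {z : Obs p | z.1 ∈ jackknifePI A α₁ α₂ δ z.2 (trainingData Z ω)} - (α₂ - α₁) := by
    filter_upwards [ae_condCoverage_eq (A := A) hZ] with ω hω hgap α₁ α₂ h1 h2 h3
    rw [← hω]
    exact neg_le_worstCoverageGap_iff.1 hgap α₁ α₂ h1 h2 h3
  have hJ := integral_jackknifeCDF hA hZ
  have hE := integral_errorCDF hA hZ
  have hJ1 : ∀ t ω, jackknifeCDF A (trainingData Z ω) t ∈ Set.Icc (0 : ℝ) 1 := fun t ω =>
    ⟨jackknifeCDF_nonneg A _ t, jackknifeCDF_le_one A _ t⟩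
  have hE1 : ∀ t ω, errorCDF A P (trainingData Z ω) t ∈ Set.Icc (0 : ℝ) 1 := fun t ω =>
    ⟨measureReal_nonneg, measureReal_le_one⟩
  constructor
  · rw [← (hJ _).2, ← (hE _).2, ← add_assoc]
    refine integral_le_integral_add_of_measure_ge (hE _).1 (hJ _).1 (hE1 _) (hJ1 _)
      (by positivity) hκ ?_
    filter_upwards [hcov] with ω hω hgap
    exact errorCDF_le_jackknifeCDF_of_coverage P hA hε hδ (hω hgap) t
  · rw [← (hJ _).2, ← (hE _).2, ← add_assoc]
    refine integral_le_integral_add_of_measure_ge (hJ _).1 (hE _).1 (hJ1 _) (hE1 _)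
      (by positivity) hκ ?_
    filter_upwards [hcov] with ω hω hgap
    refine (jackknifeCDF_le_errorCDF_of_coverage P (hω hgap) t).trans ?_
    have := errorCDF_mono (A := A) P (trainingData Z ω) (by linarith : t + δ ≤ t + 2 * δ)
    linarith

end Conservativeness

/-! ### The asymptotic equivalence -/

section Asymptotics

/-- No measurability of `S` is needed, so this applies to events defined by an infimum over
uncountably many levels. -/
lemma one_sub_le_measureReal_of_ae {Ω : Type*} [MeasurableSpace Ω] {μ : Measure Ω}
    [IsProbabilityMeasure μ] {S B : Set Ω} {κ : ℝ} (hB : μ.real B ≤ κ)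
    (h : ∀ᵐ ω ∂μ, ω ∉ B → ω ∈ S) : 1 - κ ≤ μ.real S := by
  have h1 : μ Set.univ ≤ μ (S ∪ B) := measure_mono_ae (by
    filter_upwards [h] with ω hω _
    by_cases hb : ω ∈ B
    · exact Or.inr hb
    · exact Or.inl (hω hb))
  have h2 : μ.real Set.univ ≤ μ.real (S ∪ B) := ENNReal.toReal_mono (measure_ne_top _ _) h1
  rw [probReal_univ] at h2
  linarith [measureReal_union_le (μ := μ) S B]

lemma tendsto_measure_one_iff {Ω : ℕ → Type*} [∀ k, MeasurableSpace (Ω k)]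
    {μ : ∀ k, Measure (Ω k)} [∀ k, IsProbabilityMeasure (μ k)] {S : ∀ k, Set (Ω k)} :
    Tendsto (fun k => μ k (S k)) atTop (𝓝 1) ↔
      ∀ κ : ℝ, 0 < κ → ∀ᶠ k in atTop, 1 - κ ≤ (μ k).real (S k) := by
  rw [← ENNReal.tendsto_toReal_iff (fun k => measure_ne_top _ _) ENNReal.one_ne_top,
    ENNReal.toReal_one]
  refine ⟨fun h κ hκ => (h.eventually (lt_mem_nhds (by linarith : 1 - κ < 1))).mono
    fun k hk => hk.le, fun h => tendsto_order.2 ⟨fun a ha => ?_, fun a ha =>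
      Eventually.of_forall fun k => lt_of_le_of_lt (measureReal_le_one (μ := μ k)) ha⟩⟩
  filter_upwards [h ((1 - a) / 2) (by linarith)] with k hk
  exact lt_of_lt_of_le (by linarith) hk

lemma tendsto_zero_of_abs_sub_le {u v s : ℕ → ℝ} {B : ℝ} (h : ∀ k, |u k - v k| ≤ B * √(s k))
    (hs : Tendsto s atTop (𝓝 0)) (hv : Tendsto v atTop (𝓝 0)) : Tendsto u atTop (𝓝 0) := by
  have h0 : Tendsto (fun k => B * √(s k)) atTop (𝓝 0) := by
    simpa using (hs.sqrt).const_mul B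
  have h1 : Tendsto (fun k => u k - v k) atTop (𝓝 0) := squeeze_zero_norm h h0
  simpa using h1.add hv

end Asymptotics

/-- The sample size at stage `k` is `n = k + 2`, so that `k = 0, 1, 2, …` runs through all `n ≥ 2`;
dimension, law and probability space may all change with `k`. -/
theorem mainTheorem8 (A : PredictionAlgorithm) (hA : A.IsMeasurable) (hsymm : A.IsSymmetric)
    (p : ℕ → ℕ) (P : ∀ k : ℕ, Measure (Obs (p k)))
    {Ω : ℕ → Type*} [∀ k, MeasurableSpace (Ω k)]
    (μ : ∀ k, Measure (Ω k)) [∀ k, IsProbabilityMeasure (μ k)]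
    (Z : ∀ k, Fin (k + 2 + 1) → Ω k → Obs (p k))
    (hZ : ∀ k, IsIIDSample (Z k) (P k) (μ k))
    (ξ : ℝ) (hξ : 0 < ξ)
    (hpred : UniformlyBoundedMoments μ (fun k => predictor A (Z k)) (2 + ξ))
    (hloo : UniformlyBoundedMoments μ (fun k => predictorLoo A (Z k)) (2 + ξ))
    (hresp : UniformlyBoundedMoments μ (fun k ω => (newPair (Z k) ω).1) (2 + ξ))
    (hdrift : Tendsto (fun k => ∫ ω, (updateDrift A (Z k) (μ k) ω) ^ 2 ∂(μ k)) atTop (𝓝 0)) :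
    (∀ ε : ℝ, 0 < ε → ∀ δ : ℝ, 0 < δ →
      Tendsto (fun k => μ k {ω | -ε ≤ worstCoverageGap A (Z k) (μ k) δ ω}) atTop (𝓝 1)) ↔
    Tendsto (fun k => variance (predictor A (Z k)) (μ k) - variance (predictorLoo A (Z k)) (μ k))
      atTop (𝓝 0) := by 
  obtain ⟨Ca, hCa⟩ := hpred
  obtain ⟨Cb, hCb⟩ := hloo
  obtain ⟨Cy, hCy⟩ := hresp
  have hP : ∀ k, IsProbabilityMeasure (P k) := fun k => (hZ k).isProbabilityMeasure
  have hq : (2 : ℝ) ≤ 2 + ξ := by linarith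
  have hq0 : (0 : ℝ) ≤ 2 + ξ := by linarith
  have mA : ∀ k, Measurable (predictor A (Z k)) := fun k => measurable_predictor hA (hZ k)
  have mB : ∀ k, Measurable (predictorLoo A (Z k)) := fun k => measurable_predictorLoo hA (hZ k)
  have mY : ∀ k, Measurable fun ω => (newPair (Z k) ω).1 := fun k =>
    measurable_fst.comp ((hZ k).measurable _)
  have ha := fun k => memLp_two_of_lintegral_rpow_le (mA k) hq (hCa k)
  have hb := fun k => memLp_two_of_lintegral_rpow_le (mB k) hq (hCb k)
  have hy := fun k => memLp_two_of_lintegral_rpow_le (mY k) hq (hCy k)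
  -- one bound for all second moments
  set B : ℝ := 1 + (Ca + Cb + Cy : ℝ≥0) with hB
  have hBe : B = 1 + (Ca + Cb + Cy : ℝ) := by rw [hB]; push_cast; ring
  have haB : ∀ k, ∫ ω, predictor A (Z k) ω ^ 2 ∂(μ k) ≤ B := fun k => (ha k).2.trans (by
    rw [hBe]; linarith [NNReal.coe_nonneg Cb, NNReal.coe_nonneg Cy])
  have hbB : ∀ k, ∫ ω, predictorLoo A (Z k) ω ^ 2 ∂(μ k) ≤ B := fun k => (hb k).2.trans (by
    rw [hBe]; linarith [NNReal.coe_nonneg Ca, NNReal.coe_nonneg Cy])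
  have hyB : ∀ k, ∫ ω, (newPair (Z k) ω).1 ^ 2 ∂(μ k) ≤ B := fun k => (hy k).2.trans (by
    rw [hBe]; linarith [NNReal.coe_nonneg Ca, NNReal.coe_nonneg Cb])
  let U : ℕ → ℝ := fun k => ∫ ω, (predictor A (Z k) ω - predictorLoo A (Z k) ω) ^ 2 ∂(μ k)
  have hvar : ∀ k, |variance (predictor A (Z k)) (μ k) - variance (predictorLoo A (Z k)) (μ k)
      - U k| ≤ 4 * √B * √(∫ ω, updateDrift A (Z k) (μ k) ω ^ 2 ∂(μ k)) := fun k =>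
    abs_variance_sub_sub_integral_sq_le hA (hZ k) (ha k).1 (hb k).1 (haB k) (hbB k)
  have herr : ∀ k, |∫ ω, ((newPair (Z k) ω).1 - predictor A (Z k) ω) ^ 2 ∂(μ k)
      - ∫ ω, ((newPair (Z k) ω).1 - predictorLoo A (Z k) ω) ^ 2 ∂(μ k) - U k| ≤
      4 * √B * √(∫ ω, updateDrift A (Z k) (μ k) ω ^ 2 ∂(μ k)) := fun k =>
    abs_integral_sq_error_sub_sub_integral_sq_le hA (hZ k) (ha k).1 (hb k).1 (hy k).1
      (hyB k) (hbB k)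
  constructor
  · intro hcons
    set K : ℝ := 2 ^ (2 + ξ) * (Cy + (Ca + Cb)) with hK
    have hua := fun k => integral_abs_sub_rpow_le (mY k) (mA k) hq0 (hCy k) (hCa k)
    have hub := fun k => integral_abs_sub_rpow_le (mY k) (mB k) hq0 (hCy k) (hCb k)
    have h2q : (0 : ℝ) ≤ 2 ^ (2 + ξ) := by positivity
    have huaK := fun k => (hua k).2.trans (mul_le_mul_of_nonneg_left
      (by linarith [NNReal.coe_nonneg Cb] : (Cy : ℝ) + Ca ≤ Cy + (Ca + Cb)) h2q)
    have hubK := fun k => (hub k).2.trans (mul_le_mul_of_nonneg_left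
      (by linarith [NNReal.coe_nonneg Ca] : (Cy : ℝ) + Cb ≤ Cy + (Ca + Cb)) h2q)
    have hdiff : Tendsto (fun k => ∫ ω, ((newPair (Z k) ω).1 - predictor A (Z k) ω) ^ 2 ∂(μ k)
        - ∫ ω, ((newPair (Z k) ω).1 - predictorLoo A (Z k) ω) ^ 2 ∂(μ k)) atTop (𝓝 0) := by
      refine Metric.tendsto_nhds.2 fun e he => ?_
      obtain ⟨M, hMK, hM⟩ : ∃ M : ℝ, K / M ^ ξ < e / 4 ∧ 0 < M :=
        ((((tendsto_rpow_atTop hξ).const_div_atTop K).eventually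
          (gt_mem_nhds (by positivity : (0 : ℝ) < e / 4))).and (eventually_gt_atTop 0)).exists
      -- tolerances for which the truncated parts contribute `e / 2` and the tails `e / 4`
      filter_upwards [tendsto_measure_one_iff.1
        (hcons (e / (32 * M ^ 2)) (by positivity) (e / (64 * M)) (by positivity))
        (e / (16 * M ^ 2)) (by positivity)] with k hk
      have hlevy := levy_close_of_measureReal_coverage_ge hA (hZ k) (δ := e / (64 * M))
        (ε := e / (32 * M ^ 2)) (by positivity) (by positivity) hk
      have e1 : 2 * (2 * M * (2 * (2 * (e / (64 * M))))
          + (2 * (e / (32 * M ^ 2)) + e / (16 * M ^ 2)) * M ^ 2) = e / 2 := by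
        field_simp
        ring
      have c1 := integral_sq_le_of_levy_close ((mY k).sub (mA k)) ((mY k).sub (mB k))
        ((hy k).1.sub (ha k).1).integrable_sq ((hy k).1.sub (hb k).1).integrable_sq hM
        (by positivity) (by positivity) hξ (hub k).1 (hubK k)
        (fun t => (hlevy t).1) (fun t => (hlevy t).2)
      have c2 := integral_sq_le_of_levy_close ((mY k).sub (mB k)) ((mY k).sub (mA k))
        ((hy k).1.sub (hb k).1).integrable_sq ((hy k).1.sub (ha k).1).integrable_sq hM
        (by positivity) (by positivity) hξ (hua k).1 (huaK k)
        (fun t => (hlevy t).2) (fun t => (hlevy t).1)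
      rw [e1] at c1 c2
      simp only [Pi.sub_apply] at c1 c2
      rw [Real.dist_eq, sub_zero, abs_lt]
      constructor <;> linarith
    have hU : Tendsto U atTop (𝓝 0) :=
      tendsto_zero_of_abs_sub_le (fun k => by rw [abs_sub_comm]; exact herr k) hdrift hdiff
    exact tendsto_zero_of_abs_sub_le hvar hdrift hU
  · intro hstab ε hε δ hδ
    have hU : Tendsto U atTop (𝓝 0) :=
      tendsto_zero_of_abs_sub_le (fun k => by rw [abs_sub_comm]; exact hvar k) hdrift hstab
    refine tendsto_measure_one_iff.2 fun κ hκ => ?_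
    have hB0 : 0 < B := by rw [hB]; positivity
    have hu2 : ∀ k, ∫ ω, ((newPair (Z k) ω).1 - predictor A (Z k) ω) ^ 2 ∂(μ k) ≤ 4 * B := by
      intro k
      have i1 := (hy k).1.integrable_sq
      have i2 := (ha k).1.integrable_sq
      have i3 : Integrable (fun ω => 2 * (newPair (Z k) ω).1 ^ 2 + 2 * predictor A (Z k) ω ^ 2)
          (μ k) := (i1.const_mul 2).add (i2.const_mul 2)
      calc _ ≤ ∫ ω, (2 * (newPair (Z k) ω).1 ^ 2 + 2 * predictor A (Z k) ω ^ 2) ∂(μ k) :=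
            integral_mono ((hy k).1.sub (ha k).1).integrable_sq i3 fun ω => by
              simp only [Pi.sub_apply]
              nlinarith [sq_nonneg ((newPair (Z k) ω).1 + predictor A (Z k) ω)]
        _ ≤ 4 * B := by
            rw [integral_add (i1.const_mul 2) (i2.const_mul 2), integral_const_mul,
              integral_const_mul]
            linarith [hyB k, haB k]
    -- `M` makes the tail term at most `κ / 2`
    obtain ⟨M, hMκ, hM⟩ : ∃ M : ℝ, 4 * B / M ^ 2 / (ε / 4) < κ / 2 ∧ 0 < M := by
      have : Tendsto (fun M : ℝ => 4 * B / M ^ 2 / (ε / 4)) atTop (𝓝 0) := by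
        simpa using ((tendsto_pow_atTop two_ne_zero).const_div_atTop (4 * B)).div_const (ε / 4)
      exact ((this.eventually (gt_mem_nhds (by positivity : (0 : ℝ) < κ / 2))).and
        (eventually_gt_atTop 0)).exists
    obtain ⟨J, hJ⟩ := exists_nat_ge ((2 * M + δ / 4) / (δ / 4))
    rw [div_le_iff₀ (by positivity)] at hJ
    have hr : Tendsto (fun k : ℕ => ((J + 1 : ℕ) : ℝ) * ((1 / ((k + 2 : ℕ) : ℝ)
        + 10 * (1 / (δ / 4) * √(U k))) / (ε / 4) ^ 2)) atTop (𝓝 0) := by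
      have h1 : Tendsto (fun k : ℕ => 1 / ((k + 2 : ℕ) : ℝ)) atTop (𝓝 0) :=
        (tendsto_add_atTop_iff_nat (f := fun k : ℕ => 1 / (k : ℝ)) 2).2
          tendsto_one_div_atTop_nhds_zero_nat
      have h2 : Tendsto (fun k => √(U k)) atTop (𝓝 0) := by simpa using hU.sqrt
      simpa using ((h1.add ((h2.const_mul (1 / (δ / 4))).const_mul 10)).div_const
        ((ε / 4) ^ 2)).const_mul ((J + 1 : ℕ) : ℝ)
    filter_upwards [hr.eventually (gt_mem_nhds (by positivity : (0 : ℝ) < κ / 2))] with k hk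
    obtain ⟨S, hS, hSgap⟩ := exists_coverage_exceptional_set hA hsymm (hZ k) (ha k).1 (hb k).1
      (hy k).1 (by positivity : 0 < δ / 4) (by positivity : 0 < ε / 4) hM hJ
    -- Jensen's inequality
    have hL1 : ∫ ω, |predictor A (Z k) ω - predictorLoo A (Z k) ω| ∂(μ k) ≤ √(U k) := by
      have := abs_integral_le_sqrt (μ := μ k) ((ha k).1.sub (hb k).1).abs
      simp only [Pi.abs_apply, Pi.sub_apply, sq_abs] at this
      exact (le_abs_self _).trans this
    refine one_sub_le_measureReal_of_ae (B := S) (hS.trans ?_) ?_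
    · have h1 : (∫ ω, ((newPair (Z k) ω).1 - predictor A (Z k) ω) ^ 2 ∂(μ k)) / M ^ 2 / (ε / 4) ≤
          4 * B / M ^ 2 / (ε / 4) := by
        gcongr
        exact hu2 k
      have h2 : ((J + 1 : ℕ) : ℝ) * ((1 / ((k + 2 : ℕ) : ℝ) + 10 * (1 / (δ / 4) *
          ∫ ω, |predictor A (Z k) ω - predictorLoo A (Z k) ω| ∂(μ k))) / (ε / 4) ^ 2) ≤
          ((J + 1 : ℕ) : ℝ) * ((1 / ((k + 2 : ℕ) : ℝ)
        + 10 * (1 / (δ / 4) * √(U k))) / (ε / 4) ^ 2) := by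
        gcongr
      linarith
    · filter_upwards [hSgap] with ω hω hωS
      have := hω hωS
      have e1 : 4 * (ε / 4) = ε := by ring
      have e2 : 4 * (δ / 4) = δ := by ring
      rwa [e1, e2] at this
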